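/- Let $N\ge 0$, $R>0$, and let $\Gamma_1,\dots,\Gamma_N$ be nonzero real numbers, $\boldsymbol\Gamma=(\Gamma_1,\dots,\Gamma_N)$. Write $\varphi=(\varphi_1,\dots,\varphi_N)\in(\mathbb C^2)^N$, $\varphi_i=(z_i,u_i)$. Equip $(\mathbb C^2)^N$ with the symplectic form $\Omega=-d\Theta$, $\Theta=-\frac2R\sum_i\Gamma_i\,\mathrm{Im}(\varphi_i^*d\varphi_i)$, with the action of $\mathbb T^N=(\mathbb S^1)^N$ given by $(e^{i\theta_1},\dots,e^{i\theta_N})\cdot\varphi=(e^{i\theta_1}\varphi_1,\dots,e^{i\theta_N}\varphi_N)$, with its momentum map $\mathbf J(\varphi)=-\frac2R(\Gamma_1\|\varphi_1\|^2,\dots,\Gamma_N\|\varphi_N\|^2)$, and with the Hamiltonian $$H(\varphi)=-\frac1{4\pi R^2}\sum_{i<j}\Gamma_i\Gamma_j\ln\!\big[(\|\varphi_i\|^2+\|\varphi_j\|^2)^2-4|\varphi_i^*\varphi_j|^2\big],$$ considered where the arguments of the logarithms do not vanish. Let $\mathbb S^2_R\subset\mathbb R^3$ and $\mathbb S^3_{\sqrt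 R}\subset\mathbb C^2$ be the spheres of radius $R$ and $\sqrt R$ centred at the origin, let $\Omega_i(x_i)(v_i,w_i)=\frac1R\,x_i\cdot(v_i\times w_i)$ be the area form of the $i$-th copy of $\mathbb S^2_R$, and let $h(z,u)=(2\,\mathrm{Re}(\bar zu),\,2\,\mathrm{Im}(\bar zu),\,|z|^2-|u|^2)$ be the Hopf map. Then: 1. (Quotient.) $\mathbf J^{-1}(-2\boldsymbol\Gamma)=(\mathbb S^3_{\sqrt R})^N$, the value $-2\boldsymbol\Gamma$ is regular, $\mathbb T^N$ acts freely on this level set, and the Marsden–Weinstein quotient is $$\mathbf J^{-1}(-2\boldsymbol\Gamma)/\mathbb T^N=(\mathbb S^3_{\sqrt R}/\mathbb S^1)^N=(\mathbb S^2_R)^N .$$ Here the first identification is $[\varphi]\mapsto([\varphi_1],\dots,[\varphi_N])$ and the second is the diffeomorphism induced by $h$ on each factor. The map $\varphi\mapsto(h(\varphi_1),\dots,h(\varphi_N))$ is a surjective submersion $\mathbf J^{-1}(-2\boldsymbol\Gamma)\to(\mathbb S^2_R)^N$ whose fibres are the $\mathbb T^N$-orbits, and the reduced symplectic form (the form whose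 pull-back to $\mathbf J^{-1}(-2\boldsymbol\Gamma)$ is the restriction of $\Omega$) is $R^{-2}\sum_i\Gamma_i\,\pi_i^*\Omega_i$, where $\pi_i:(\mathbb S^2_R)^N\to\mathbb S^2_R$ is the $i$-th projection. 2. (Dynamics.) Hamilton's equations $\iota_X\Omega=dH$ are the lifted vortex equations $$\Gamma_i\dot\varphi_i=-\frac{iR}2\,\frac{\partial H}{\partial\varphi_i^*},\qquad i=1,\dots,N.$$ The function $H$ is $\mathbb T^N$-invariant, and it descends to $H_{\mathbb S^2_R}(x)=-\frac1{4\pi R^2}\sum_{i<j}\Gamma_i\Gamma_j\ln(2(R^2-x_i\cdot x_j))$ on $(\mathbb S^2_R)^N$. The lifted equations leave $\mathbf J^{-1}(-2\boldsymbol\Gamma)$ invariant and reduce on $(\mathbb S^2_R)^N$, away from collisions, to the point vortex equations $$\dot x_i=\frac1{2\pi R}\sum_{j\ne i}\Gamma_j\,\frac{x_j\times x_i}{|x_i-x_j|^2},\qquad i=1,\dots,N.$$ That is, the lifted vector field is tangent to the level set and projects onto the vortex vector field, which is the Hamiltonian vector field of $H_{\mathbb S^2_R}$ for the reduced symplectic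 form; and every solution of the lifted equations on an open interval that meets the level set stays in it and projects to a solution of the point vortex equations. For the equations $\Gamma_i\dot\varphi_i=-\frac i2\,\partial H/\partial\varphi_i^*$ without the factor $R$ the same holds up to the constant change of time $t\mapsto Rt$ (so exactly as stated if $R=1$): if $\varphi$ is a solution that meets the level set, then it stays in it and $t\mapsto (h(\varphi_i(Rt)))_i$ solves the point vortex equations. -/

import Mathlib

open Set Filter Topology
open scoped ContDiff

noncomputable section

/-! ### Calculus on subsets of normed spaces -/

section Calculus

variable {V W : Type*} [NormedAddCommGroup V] [NormedSpace ℝ V]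
  [NormedAddCommGroup W] [NormedSpace ℝ W]

/-- A map defined on a subset `A` of a normed space is smooth at `p` if near `p` it is the
restriction of a smooth map defined on an open subset of the ambient space. -/
def SmoothOnSubsetAt {A : Set V} (f : A → W) (p : A) : Prop :=
  ∃ U : Set V, IsOpen U ∧ (p : V) ∈ U ∧
    ∃ g : V → W, ContDiffOn ℝ ∞ g U ∧ ∀ q : A, (q : V) ∈ U → f q = g q

/-- `A` is an embedded smooth submanifold (without boundary) of codimension `k`: locally it is the
zero set of a submersion to `ℝᵏ`. -/
def IsSubmanifoldOfCodim (A : Set V) (k : ℕ) : Prop :=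
  ∀ p ∈ A, ∃ U : Set V, IsOpen U ∧ p ∈ U ∧
    ∃ F : V → EuclideanSpace ℝ (Fin k), ContDiffOn ℝ ∞ F U ∧
      A ∩ U = {q ∈ U | F q = 0} ∧ ∀ q ∈ U, Function.Surjective (fderiv ℝ F q)

/-- The tangent space of `A` at `p`: velocities at time `0` of smooth curves in `A` through `p`. -/
def tangentVectors (A : Set V) (p : V) : Set V :=
  {v | ∃ ε > 0, ∃ γ : ℝ → V, ContDiffOn ℝ ∞ γ (Ioo (-ε) ε) ∧
    (∀ t ∈ Ioo (-ε) ε, γ t ∈ A) ∧ γ 0 = p ∧ HasDerivAt γ v 0}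

/-- Exterior derivative of a one-form `θ`, evaluated at `p` on `v`, `w`. -/
def extDerivOne (θ : V → V → ℝ) (p v w : V) : ℝ :=
  fderiv ℝ (fun q => θ q w) p v - fderiv ℝ (fun q => θ q v) p w

/-- Exterior derivative of a two-form `τ`, evaluated at `p` on `u`, `v`, `w`. -/
def extDerivTwo (τ : V → V → V → ℝ) (p u v w : V) : ℝ :=
  fderiv ℝ (fun q => τ q v w) p u - fderiv ℝ (fun q => τ q u w) p v
    + fderiv ℝ (fun q => τ q u v) p w

/-- The restriction of the smooth ambient two-form `τ` to the submanifold `A` is a symplectic form: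
it is closed and nondegenerate on the tangent spaces of `A`. -/
structure IsSymplecticOn (A : Set V) (τ : V → V → V → ℝ) : Prop where
  smooth : ∀ v w, ContDiff ℝ ∞ fun p => τ p v w
  alternating : ∀ p, ∃ B : V →ₗ[ℝ] V →ₗ[ℝ] ℝ, B.IsAlt ∧ ∀ v w, τ p v w = B v w
  closed : ∀ p ∈ A, ∀ u ∈ tangentVectors A p, ∀ v ∈ tangentVectors A p,
    ∀ w ∈ tangentVectors A p, extDerivTwo τ p u v w = 0
  nondegenerate : ∀ p ∈ A, ∀ v ∈ tangentVectors A p,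
    (∀ w ∈ tangentVectors A p, τ p v w = 0) → v = 0

variable {G : Type*} [Group G] [MulAction G V]

/-- The orbit space `L / G` of an invariant subset `L`, with the quotient topology. -/
abbrev OrbitSpace (L : SubMulAction G V) : Type _ := Quotient (MulAction.orbitRel G L)

/-- The projection `L → L / G`. -/
def toOrbit (L : SubMulAction G V) (p : L) : OrbitSpace L :=
  Quotient.mk (MulAction.orbitRel G L) p

/-- The quotient smooth structure: a map on `L / G` is smooth at `q` if its pull-back to `L` is
smooth at the points over `q`. -/
def SmoothOnOrbitSpaceAt {L : SubMulAction G V} (f : OrbitSpace L → W) (q : OrbitSpace L) : Prop :=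
  ∀ p : L, toOrbit L p = q →
    SmoothOnSubsetAt (A := (L : Set V)) (fun p' => f (toOrbit L p')) p

/-- The homeomorphism `Φ` from the orbit space `L / G` to the subset `P` of a normed space is a
diffeomorphism: it identifies the germs of smooth functions. -/
def IsOrbitDiffeo {L : SubMulAction G V} {P : Set W} (Φ : OrbitSpace L ≃ₜ P) : Prop :=
  ∀ (f : P → ℝ) (q : OrbitSpace L),
    SmoothOnSubsetAt f (Φ q) ↔ SmoothOnOrbitSpaceAt (fun q' => f (Φ q')) q

end Calculus

/-! ### The phase space `(ℂ²)ᴺ`, the torus action and Marsden–Weinstein reduction -/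

/-- `ℂ²`, with its Hermitian norm; `φ 0 = z` and `φ 1 = u`. -/
abbrev C2 : Type := EuclideanSpace ℂ (Fin 2)

/-- `ℝ³`, with its Euclidean norm. -/
abbrev R3 : Type := EuclideanSpace ℝ (Fin 3)

/-- `(ℂ²)ᴺ`. -/
abbrev PhaseSpace (N : ℕ) : Type := Fin N → C2

/-- The torus `𝕋ᴺ`; it acts on `(ℂ²)ᴺ` by `(g • φ) i = g i • φ i`. -/
abbrev Torus (N : ℕ) : Type := Fin N → Circle

/-- The infinitesimal generator on `(ℂ²)ᴺ` of the element `ξ` of the Lie algebra `ℝᴺ` of `𝕋ᴺ`. -/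
def torusGenerator {N : ℕ} (ξ : Fin N → ℝ) (φ : PhaseSpace N) : PhaseSpace N :=
  deriv (fun s : ℝ => ((fun i => Circle.exp (s * ξ i) : Torus N) • φ : PhaseSpace N)) 0

/-- `(P, ωP)` together with `p : J⁻¹(μ) → P` (the restriction to `J⁻¹(μ)` of a smooth map) is the
Marsden–Weinstein quotient `J⁻¹(μ)/𝕋ᴺ` of `((ℂ²)ᴺ, Ω)` by the `𝕋ᴺ`-action with momentum map `J` at
the level `μ`: the action is symplectic with invariant momentum map `J` (for the convention
`ι_{ξ} Ω = d⟨J, ξ⟩`), `μ` is a regular value, `𝕋ᴺ` acts freely on `J⁻¹(μ)`, the map `p` is a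
surjective submersion whose fibres are the `𝕋ᴺ`-orbits, and the symplectic form `ωP` pulls back
under `p` to the restriction of `Ω` to `J⁻¹(μ)`. The space `P` is a submanifold of codimension `k`
of a normed space. -/
structure IsMarsdenWeinsteinQuotient {N : ℕ} {W : Type*} [NormedAddCommGroup W] [NormedSpace ℝ W]
    (Ω : PhaseSpace N → PhaseSpace N → PhaseSpace N → ℝ) (J : PhaseSpace N → Fin N → ℝ)
    (μ : Fin N → ℝ) (P : Set W) (k : ℕ) (ωP : W → W → W → ℝ) (p : PhaseSpace N → W) : Prop where
  symplectic : IsSymplecticOn univ Ω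
  invariant_form : ∀ (g : Torus N) (φ v w : PhaseSpace N), Ω (g • φ) (g • v) (g • w) = Ω φ v w
  smooth_momentum : ContDiff ℝ ∞ J
  momentum : ∀ (ξ : Fin N → ℝ) (φ w : PhaseSpace N),
    Ω φ (torusGenerator ξ φ) w = fderiv ℝ (fun ψ => ∑ i, J ψ i * ξ i) φ w
  invariant_momentum : ∀ (g : Torus N) (φ : PhaseSpace N), J (g • φ) = J φ
  regular : ∀ φ ∈ J ⁻¹' {μ}, Function.Surjective (fderiv ℝ J φ)
  free : ∀ (g : Torus N), ∀ φ ∈ J ⁻¹' {μ}, g • φ = φ → g = 1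
  submanifold : IsSubmanifoldOfCodim P k
  symplectic_quotient : IsSymplecticOn P ωP
  smooth : ContDiff ℝ ∞ p
  image : p '' (J ⁻¹' {μ}) = P
  fibres : ∀ φ ∈ J ⁻¹' {μ}, ∀ ψ ∈ J ⁻¹' {μ}, p φ = p ψ ↔ ∃ g : Torus N, ψ = g • φ
  submersion : ∀ φ ∈ J ⁻¹' {μ},
    fderiv ℝ p φ '' tangentVectors (J ⁻¹' {μ}) φ = tangentVectors P (p φ)
  pullback : ∀ φ ∈ J ⁻¹' {μ}, ∀ v ∈ tangentVectors (J ⁻¹' {μ}) φ,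
    ∀ w ∈ tangentVectors (J ⁻¹' {μ}) φ,
      ωP (p φ) (fderiv ℝ p φ v) (fderiv ℝ p φ w) = Ω φ v w

/-! ### The lifted vortex system on `(ℂ²)ᴺ` -/

section Lifted

variable {N : ℕ} (R : ℝ) (Γ : Fin N → ℝ)

/-- The one-form `Θ = -(2/R) ∑ Γᵢ Im(φᵢ* dφᵢ)`. -/
def liftedTheta (φ v : PhaseSpace N) : ℝ :=
  -(2 / R) * ∑ i, Γ i * (inner ℂ (φ i) (v i)).im

/-- The symplectic form `Ω = -dΘ`. -/
def liftedOmega (φ v w : PhaseSpace N) : ℝ :=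
  -extDerivOne (liftedTheta R Γ) φ v w

/-- The momentum map `J(φ) = -(2/R) (Γ₁‖φ₁‖², …, Γ_N‖φ_N‖²)`. -/
def momentumMap (φ : PhaseSpace N) : Fin N → ℝ :=
  fun i => -(2 / R) * (Γ i * ‖φ i‖ ^ 2)

/-- `(‖φᵢ‖² + ‖φⱼ‖²)² - 4 |φᵢ* φⱼ|²`. -/
def liftedDistSq (φ : PhaseSpace N) (i j : Fin N) : ℝ :=
  (‖φ i‖ ^ 2 + ‖φ j‖ ^ 2) ^ 2 - 4 * ‖inner ℂ (φ i) (φ j)‖ ^ 2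

/-- The lifted Hamiltonian `H` on `(ℂ²)ᴺ`. -/
def liftedHamiltonian (φ : PhaseSpace N) : ℝ :=
  -(1 / (4 * Real.pi * R ^ 2)) *
    ∑ i, ∑ j ∈ Finset.Ioi i, Γ i * Γ j * Real.log (liftedDistSq φ i j)

/-- The configurations in `(ℂ²)ᴺ` at which no logarithm in the lifted Hamiltonian is singular. -/
def liftedNonCollision (N : ℕ) : Set (PhaseSpace N) :=
  {φ | ∀ i j, i ≠ j → liftedDistSq φ i j ≠ 0}

/-- The vectors `∂F/∂φᵢ*` in `ℂ²` of Wirtinger derivatives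
`∂F/∂z̄ = (∂F/∂a + i ∂F/∂b) / 2`, `z = a + i b`. -/
def conjGradient (F : PhaseSpace N → ℝ) (φ : PhaseSpace N) : PhaseSpace N := fun i =>
  WithLp.toLp 2 fun k =>
    (1 / 2 : ℂ) *
      ((fderiv ℝ F φ (Pi.single i (EuclideanSpace.single k (1 : ℂ))) : ℂ)
        + Complex.I * (fderiv ℝ F φ (Pi.single i (EuclideanSpace.single k Complex.I)) : ℂ))

/-- `X` is the value at `φ` of the right-hand side of
`Γᵢ φ̇ᵢ = -(i c / 2) ∂H/∂φᵢ*`, `i = 1, …, N`. -/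
def IsLiftedVelocity (c : ℝ) (φ X : PhaseSpace N) : Prop :=
  ∀ i, (Γ i : ℂ) • X i =
    (-(Complex.I * (c : ℂ) / 2)) • conjGradient (liftedHamiltonian R Γ) φ i

/-- `φ` is a solution of `Γᵢ φ̇ᵢ = -(i c / 2) ∂H/∂φᵢ*`, `i = 1, …, N`, on the time set `I`. -/
def IsLiftedSolution (c : ℝ) (φ : ℝ → PhaseSpace N) (I : Set ℝ) : Prop :=
  ∀ t ∈ I, φ t ∈ liftedNonCollision N ∧
    ∃ X, HasDerivAt φ X t ∧ IsLiftedVelocity R Γ c (φ t) X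

/-- The level set `J⁻¹(-2Γ)`, as a `𝕋ᴺ`-invariant subset. -/
def momentumLevel : SubMulAction (Torus N) (PhaseSpace N) where
  carrier := momentumMap R Γ ⁻¹' {fun i => -2 * Γ i}
  smul_mem' g φ h := by
    have hn : momentumMap R Γ (g • φ) = momentumMap R Γ φ := by
      funext i
      simp only [momentumMap, Pi.smul_apply', Circle.smul_def, norm_smul, Circle.norm_coe, one_mul]
    simpa [hn] using h

end Lifted

/-- The three-sphere of radius `√R` in `ℂ²`, as an `𝕊¹`-invariant subset. -/
def threeSphere (R : ℝ) : SubMulAction Circle C2 where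
  carrier := Metric.sphere 0 (Real.sqrt R)
  smul_mem' g φ h := by
    rw [mem_sphere_zero_iff_norm] at h ⊢
    rw [Circle.smul_def, norm_smul, Circle.norm_coe, one_mul, h]

/-! ### Point vortices on the sphere -/

/-- The cross product of `ℝ³`. -/
def cross3 (v w : R3) : R3 :=
  WithLp.toLp 2 (crossProduct (WithLp.ofLp v) (WithLp.ofLp w))

/-- The Hopf map `(z, u) ↦ (2 Re(z̄u), 2 Im(z̄u), |z|² - |u|²)`. -/
def hopf (φ : C2) : R3 :=
  !₂[2 * (star (φ 0) * φ 1).re, 2 * (star (φ 0) * φ 1).im, ‖φ 0‖ ^ 2 - ‖φ 1‖ ^ 2]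

/-- The Hopf map on each of the `N` copies. -/
def hopfN {N : ℕ} (φ : PhaseSpace N) : Fin N → R3 := fun i => hopf (φ i)

/-- `(𝕊²_R)ᴺ` in `(ℝ³)ᴺ`. -/
def sphereProduct (N : ℕ) (R : ℝ) : Set (Fin N → R3) :=
  {x | ∀ i, x i ∈ Metric.sphere (0 : R3) R}

section Vortices

variable {N : ℕ} (R : ℝ) (Γ : Fin N → ℝ)

/-- The area form `(1/R) x · (v × w)` of `𝕊²_R`. -/
def areaForm (x v w : R3) : ℝ := (1 / R) * inner ℝ x (cross3 v w)

/-- The two-form `∑ Γᵢ πᵢ* Ωᵢ` on `(𝕊²_R)ᴺ`, with `Ωᵢ` the area form of the `i`-th copy. -/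
def vortexForm (x v w : Fin N → R3) : ℝ := ∑ i, Γ i * areaForm R (x i) (v i) (w i)

/-- The Hamiltonian of the point vortices on `𝕊²_R`. -/
def vortexHamiltonian (x : Fin N → R3) : ℝ :=
  -(1 / (4 * Real.pi * R ^ 2)) *
    ∑ i, ∑ j ∈ Finset.Ioi i, Γ i * Γ j * Real.log (2 * (R ^ 2 - inner ℝ (x i) (x j)))

/-- The right-hand side of the point vortex equations on `𝕊²_R`. -/
def vortexField (x : Fin N → R3) : Fin N → R3 := fun i =>
  (1 / (2 * Real.pi * R)) •
    ∑ j ∈ Finset.univ.erase i, (Γ j / ‖x i - x j‖ ^ 2) • cross3 (x j) (x i)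

/-- `x` is a (collision-free) solution of the point vortex equations on `𝕊²_R` on the time
set `I`. -/
def IsVortexSolution (x : ℝ → Fin N → R3) (I : Set ℝ) : Prop :=
  ∀ t ∈ I, x t ∈ sphereProduct N R ∧ (∀ i j, i ≠ j → x t i ≠ x t j) ∧
    HasDerivAt x (vortexField R Γ (x t)) t

end Vortices

end

/-! ### Calculus on products of spheres and on orbit spaces -/

section General

variable {V W : Type*} [NormedAddCommGroup V] [NormedSpace ℝ V]
  [NormedAddCommGroup W] [NormedSpace ℝ W]

/-! In terms of the Pauli matrices σ the Hopf map is h(φ) = φ*σφ, and the Hermitian matrices y·σ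
(`pauli`) carry both the geometry and the dynamics. Since φφ* = ½(‖φ‖² + h(φ)·σ), the trace of
φφ*ψψ* gives 2|φ*ψ|² = ‖φ‖²‖ψ‖² + h(φ)·h(ψ) (`norm_inner_sq`). When h(φ) = h(ψ) this is equality in
Cauchy–Schwarz, so the fibres of h are circles. In general it turns the argument of each logarithm
into |h(φᵢ) - h(φⱼ)|² (`liftedDistSq_eq`), so H is a function of the Hopf images on all of (ℂ²)ᴺ,
not only on the level set.

Geometry: dh(φ) maps (y·σ)φ to 2‖φ‖²y (`dHopf_pauli`). This lifts every tangent vector of the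
two-sphere and makes h a submersion. The area form pulls back to a multiple of Im v*w on vectors
tangent to the three-sphere (`inner_hopf_cross3_dHopf`), which is Ω up to the stated constant. The
orbit space maps homeomorphically to the product of spheres by compactness; normalizing (R + y·σ)p
gives smooth local sections of h, so the homeomorphism is a diffeomorphism.

Dynamics: if gᵢ is the gradient in xᵢ of the chordal Hamiltonian, then ∂H/∂φᵢ* = (gᵢ·σ)φᵢ, and the
lifted equations read φ̇ᵢ = -(iR/2Γᵢ)(gᵢ·σ)φᵢ. As gᵢ·σ is Hermitian, each ‖φᵢ‖ is conserved. As
-(i/2)y·σ generates the rotation about y (`dHopf_I_pauli`), the image moves by ẋᵢ = (R/Γᵢ) gᵢ × xᵢ,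
which is the vortex equation. A constant c in place of R scales the projected field by c/R, whence
the time change. -/

theorem mem_tangentVectors_univ (p v : V) : v ∈ tangentVectors univ p := by
  refine ⟨1, one_pos, fun t => p + t • v, ?_, fun _ _ => mem_univ _, by simp, ?_⟩
  · exact (contDiff_const.add (contDiff_id.smul contDiff_const)).contDiffOn
  · simpa using ((hasDerivAt_id (0 : ℝ)).smul_const v).const_add p

theorem fderiv_apply_of_hasDerivAt_line {f : V → W} {p v : V} {a : W}
    (hf : DifferentiableAt ℝ f p) (h : HasDerivAt (fun t : ℝ => f (p + t • v)) a 0) :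
    fderiv ℝ f p v = a := by
  have hline : HasDerivAt (fun t : ℝ => p + t • v) v 0 := by
    simpa using ((hasDerivAt_id (0 : ℝ)).smul_const v).const_add p
  have hf' : HasFDerivAt f (fderiv ℝ f p) (p + (0 : ℝ) • v) := by simpa using hf.hasFDerivAt
  exact (hf'.comp_hasDerivAt (0 : ℝ) hline).unique h

/-- The derivative of a map which is quadratic along a line. -/
theorem fderiv_apply_of_quadratic {f : V → W} {p v : V} {a b : W} (hf : DifferentiableAt ℝ f p)
    (h : ∀ t : ℝ, f (p + t • v) = f p + t • a + t ^ 2 • b) : fderiv ℝ f p v = a := by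
  refine fderiv_apply_of_hasDerivAt_line hf ?_
  simp only [h]
  exact ((((hasDerivAt_id (0 : ℝ)).smul_const a).const_add (f p)).add
    (((hasDerivAt_id (0 : ℝ)).pow 2).smul_const b)).congr_deriv (by simp)

variable {G : Type*} [Group G] [MulAction G V]

/-- A homeomorphism from an orbit space which is induced by a smooth map with smooth local sections
is a diffeomorphism. -/
theorem isOrbitDiffeo_of_localSections {L : SubMulAction G V} {P : Set W}
    (Φ : OrbitSpace L ≃ₜ P) (h : V → W) (hsmooth : ContDiff ℝ ∞ h)
    (hΦ : ∀ p : L, (Φ (toOrbit L p) : W) = h p)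
    (hsec : ∀ p : L, ∃ O : Set W, IsOpen O ∧ h p ∈ O ∧ ∃ s : W → V, ContDiffOn ℝ ∞ s O ∧
      s (h p) = p ∧ ∀ y ∈ O ∩ P, s y ∈ L ∧ h (s y) = y) :
    IsOrbitDiffeo Φ := by
  intro f q
  constructor
  · rintro ⟨U, hU, hqU, g, hg, hfg⟩ p rfl
    refine ⟨h ⁻¹' U, hU.preimage hsmooth.continuous, ?_, g ∘ h,
      hg.comp hsmooth.contDiffOn (fun _ hx => hx), ?_⟩
    · rw [mem_preimage]
      rwa [hΦ] at hqU
    · intro p' hp'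
      have hval := hΦ p'
      change f (Φ (toOrbit L p')) = g (h p')
      rw [hfg _ (by rw [hval]; exact hp'), hval]
  · intro hq
    -- Smoothness descends by composing a smooth extension near `p` with the section `s`: as `s y`
    -- lies over `y`, the value of `f` at `y` is read off at `s y`.
    obtain ⟨p, rfl⟩ : ∃ p : L, toOrbit L p = q := Quotient.exists_rep q
    obtain ⟨U, hU, hpU, g, hg, hfg⟩ := hq p rfl
    obtain ⟨O, hO, hpO, s, hs, hsp, hsec⟩ := hsec p
    refine ⟨O ∩ s ⁻¹' U, hs.continuousOn.isOpen_inter_preimage hO hU, ?_, g ∘ s,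
      hg.comp (hs.mono inter_subset_left) (fun _ hx => hx.2), ?_⟩
    · rw [hΦ]
      exact ⟨hpO, by rw [mem_preimage, hsp]; exact hpU⟩
    · rintro y ⟨hyO, hyU⟩
      obtain ⟨hsL, hhs⟩ := hsec y ⟨hyO, y.2⟩
      have hy : Φ (toOrbit L ⟨s y, hsL⟩) = y := Subtype.ext ((hΦ _).trans hhs)
      have : f (Φ (toOrbit L ⟨s y, hsL⟩)) = g (s y) := hfg ⟨s y, hsL⟩ hyU
      rwa [hy] at this

end General

/-! ### Products of spheres: tangent spaces, compactness, submanifold structure -/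

section PiSphere

variable {E : Type*} [NormedAddCommGroup E] [InnerProductSpace ℝ E] {ι : Type*}

/-- A curve of constant norm `‖x‖` which leaves `x` with velocity `v`, if `v ⟂ x`. -/
theorem norm_rescaled_line {r : ℝ} {x v : E} (hr : 0 < r) (hx : ‖x‖ = r)
    (hv : inner ℝ x v = 0) (t : ℝ) :
    ‖(r / √(r ^ 2 + t ^ 2 * ‖v‖ ^ 2)) • (x + t • v)‖ = r := by
  have hpos : 0 < √(r ^ 2 + t ^ 2 * ‖v‖ ^ 2) := Real.sqrt_pos.2 (by positivity)
  have hn : ‖x + t • v‖ = √(r ^ 2 + t ^ 2 * ‖v‖ ^ 2) := by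
    rw [← Real.sqrt_sq (norm_nonneg (x + t • v)), norm_add_sq_real, inner_smul_right, hv, hx,
      norm_smul, mul_pow, Real.norm_eq_abs, sq_abs]
    simp
  rw [norm_smul, hn, Real.norm_of_nonneg (by positivity)]
  field_simp

/-- The rescaling factor is an even function of `t` with value 1 at 0, so its derivative vanishes
there and only the velocity of the line survives. -/
theorem hasDerivAt_rescaled_line {r : ℝ} (hr : 0 < r) (x v : E) :
    HasDerivAt (fun t : ℝ => (r / √(r ^ 2 + t ^ 2 * ‖v‖ ^ 2)) • (x + t • v)) v 0 := by
  have h0 : r ^ 2 + (0 : ℝ) ^ 2 * ‖v‖ ^ 2 = r ^ 2 := by ring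
  have h1 : HasDerivAt (fun t : ℝ => r ^ 2 + t ^ 2 * ‖v‖ ^ 2) 0 0 := by
    simpa using (((hasDerivAt_id (0 : ℝ)).pow 2).mul_const (‖v‖ ^ 2)).const_add (r ^ 2)
  have h2 := h1.sqrt (by rw [h0]; positivity)
  have h3 := (hasDerivAt_const (0 : ℝ) r).div h2 (by rw [h0, Real.sqrt_sq hr.le]; exact hr.ne')
  have h4 : HasDerivAt (fun t : ℝ => x + t • v) v 0 := by
    simpa using ((hasDerivAt_id (0 : ℝ)).smul_const v).const_add x
  refine (h3.smul h4).congr_deriv ?_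
  simp [Real.sqrt_sq hr.le, hr.ne']

/-- The tangent spaces of a product of spheres. -/
theorem mem_tangentVectors_piSphere [Fintype ι] {r : ℝ} (hr : 0 < r) {x v : ι → E}
    (hx : ∀ i, x i ∈ Metric.sphere (0 : E) r) :
    v ∈ tangentVectors {y : ι → E | ∀ i, y i ∈ Metric.sphere (0 : E) r} x ↔
      ∀ i, inner ℝ (x i) (v i) = 0 := by
  constructor
  · rintro ⟨ε, hε, γ, -, hγA, hγ0, hγ'⟩ i
    have h1 : HasDerivAt (fun t => ‖γ t i‖ ^ 2) (2 * inner ℝ (γ 0 i) (v i)) 0 :=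
      (hasDerivAt_pi.1 hγ' i).norm_sq
    have h2 : (fun t => ‖γ t i‖ ^ 2) =ᶠ[𝓝 0] fun _ => r ^ 2 := by
      filter_upwards [Ioo_mem_nhds (neg_lt_zero.2 hε) hε] with t ht
      rw [mem_sphere_zero_iff_norm.1 (hγA t ht i)]
    have h3 := h1.unique ((hasDerivAt_const (0 : ℝ) (r ^ 2)).congr_of_eventuallyEq h2)
    rw [hγ0] at h3
    linarith
  · intro hv
    refine ⟨1, one_pos, fun t i => (r / √(r ^ 2 + t ^ 2 * ‖v i‖ ^ 2)) • (x i + t • v i), ?_, ?_,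
      ?_, ?_⟩
    · refine ContDiff.contDiffOn (contDiff_pi.2 fun i => ContDiff.smul ?_ ?_)
      · refine contDiff_const.div (ContDiff.sqrt ?_ fun t => ?_) fun t => ?_
        · exact contDiff_const.add ((contDiff_id.pow 2).mul contDiff_const)
        · positivity
        · exact (Real.sqrt_pos.2 (by positivity)).ne'
      · exact contDiff_const.add (contDiff_id.smul contDiff_const)
    · intro t _ i
      rw [mem_sphere_zero_iff_norm]
      exact norm_rescaled_line hr (mem_sphere_zero_iff_norm.1 (hx i)) (hv i) t
    · ext1 i
      simp [Real.sqrt_sq hr.le, hr.ne']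
    · exact hasDerivAt_pi.2 fun i => hasDerivAt_rescaled_line hr (x i) (v i)

theorem isCompact_piSphere [FiniteDimensional ℝ E] (r : ℝ) :
    IsCompact {y : ι → E | ∀ i, y i ∈ Metric.sphere (0 : E) r} := by
  have := FiniteDimensional.proper_real E
  have := isCompact_univ_pi (fun _ : ι => isCompact_sphere (0 : E) r)
  simpa [Set.pi] using this

theorem isSubmanifoldOfCodim_piSphere {N : ℕ} {r : ℝ} (hr : 0 < r) :
    IsSubmanifoldOfCodim {y : Fin N → E | ∀ i, y i ∈ Metric.sphere (0 : E) r} N := by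
  intro p hp
  have hopen : IsOpen {y : Fin N → E | ∀ i, y i ≠ 0} := by
    rw [ofPred_forall]
    exact isOpen_iInter_of_finite fun i => isOpen_ne.preimage (continuous_apply i)
  have hdiff : ∀ i, ContDiff ℝ ∞ fun y : Fin N → E => ‖y i‖ ^ 2 - r ^ 2 := fun i =>
    ((contDiff_apply ℝ E i).norm_sq ℝ).sub contDiff_const
  refine ⟨_, hopen, fun i hi => ?_, fun y => WithLp.toLp 2 fun i => ‖y i‖ ^ 2 - r ^ 2,
    (contDiff_euclidean.2 hdiff).contDiffOn, ?_, ?_⟩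
  · have := hp i
    rw [hi, mem_sphere_zero_iff_norm, norm_zero] at this
    exact hr.ne this
  · ext y
    simp only [mem_inter_iff, mem_ofPred_eq, mem_sphere_zero_iff_norm]
    constructor
    · rintro ⟨h1, h2⟩
      refine ⟨h2, ?_⟩
      ext i
      simp [h1 i]
    · rintro ⟨h1, h2⟩
      refine ⟨fun i => ?_, h1⟩
      have := congrFun (congrArg WithLp.ofLp h2) i
      have h3 : ‖y i‖ ^ 2 = r ^ 2 := by simpa [sub_eq_zero] using this
      exact (sq_eq_sq₀ (norm_nonneg _) hr.le).1 h3
  · intro q hq w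
    -- A radial preimage: the derivative of `‖y i‖ ^ 2` at `q` along `a • q i` is `2 * a * ‖q i‖ ^
    -- 2`.
    refine ⟨fun i => (w i / (2 * ‖q i‖ ^ 2)) • q i, ?_⟩
    refine fderiv_apply_of_quadratic (b := WithLp.toLp 2 fun i => ‖(w i / (2 * ‖q i‖ ^ 2)) • q i‖ ^ 2)
      ((contDiff_euclidean.2 hdiff).differentiable (by simp) q) fun t => ?_
    ext i
    have := norm_ne_zero_iff.2 (hq i)
    simp only [Pi.add_apply, Pi.smul_apply, PiLp.add_apply, PiLp.smul_apply, smul_eq_mul,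
      norm_add_sq_real, inner_smul_right, real_inner_self_eq_norm_sq, norm_smul, mul_pow,
      Real.norm_eq_abs, sq_abs]
    field_simp
    ring

end PiSphere

/-! ### Algebra of the Hopf map -/

theorem inner_C2 (φ ψ : C2) : inner ℂ φ ψ = star (φ 0) * ψ 0 + star (φ 1) * ψ 1 := by
  simp [PiLp.inner_apply, Fin.sum_univ_two, mul_comm]

theorem real_inner_C2 (φ ψ : C2) : inner ℝ φ ψ =
    (φ 0).re * (ψ 0).re + (φ 0).im * (ψ 0).im + ((φ 1).re * (ψ 1).re + (φ 1).im * (ψ 1).im) := by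
  simp [PiLp.inner_apply, Fin.sum_univ_two, mul_comm]

theorem re_inner_C2 (φ ψ : C2) : (inner ℂ φ ψ).re = inner ℝ φ ψ := by
  simp [inner_C2, real_inner_C2]

theorem im_inner_C2 (φ ψ : C2) : (inner ℂ φ ψ).im =
    (φ 0).re * (ψ 0).im - (φ 0).im * (ψ 0).re + ((φ 1).re * (ψ 1).im - (φ 1).im * (ψ 1).re) := by
  simp [inner_C2]
  ring

theorem norm_sq_C2 (φ : C2) : ‖φ‖ ^ 2 =
    (φ 0).re ^ 2 + (φ 0).im ^ 2 + ((φ 1).re ^ 2 + (φ 1).im ^ 2) := by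
  rw [← real_inner_self_eq_norm_sq, real_inner_C2]
  ring

theorem inner_R3 (x y : R3) : inner ℝ x y = x 0 * y 0 + x 1 * y 1 + x 2 * y 2 := by
  simp [PiLp.inner_apply, Fin.sum_univ_three, mul_comm]

theorem norm_sq_R3 (x : R3) : ‖x‖ ^ 2 = x 0 ^ 2 + x 1 ^ 2 + x 2 ^ 2 := by
  simp [EuclideanSpace.real_norm_sq_eq, Fin.sum_univ_three]

theorem cross3_zero (x y : R3) : cross3 x y 0 = x 1 * y 2 - x 2 * y 1 := by
  simp [cross3, cross_apply]

theorem cross3_one (x y : R3) : cross3 x y 1 = x 2 * y 0 - x 0 * y 2 := by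
  simp [cross3, cross_apply]

theorem cross3_two (x y : R3) : cross3 x y 2 = x 0 * y 1 - x 1 * y 0 := by
  simp [cross3, cross_apply]

theorem R3_ext {x y : R3} (h0 : x 0 = y 0) (h1 : x 1 = y 1) (h2 : x 2 = y 2) : x = y := by
  ext k
  fin_cases k
  exacts [h0, h1, h2]

theorem C2_ext {x y : C2} (h0 : (x 0).re = (y 0).re) (h1 : (x 0).im = (y 0).im)
    (h2 : (x 1).re = (y 1).re) (h3 : (x 1).im = (y 1).im) : x = y := by
  ext k
  fin_cases k
  exacts [Complex.ext h0 h1, Complex.ext h2 h3]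

theorem hopf_zero (φ : C2) : hopf φ 0 = 2 * ((φ 0).re * (φ 1).re + (φ 0).im * (φ 1).im) := by
  simp [hopf]

theorem hopf_one (φ : C2) : hopf φ 1 = 2 * ((φ 0).re * (φ 1).im - (φ 0).im * (φ 1).re) := by
  simp [hopf]
  ring

theorem hopf_two (φ : C2) :
    hopf φ 2 = (φ 0).re ^ 2 + (φ 0).im ^ 2 - ((φ 1).re ^ 2 + (φ 1).im ^ 2) := by
  simp [hopf, Complex.sq_norm, Complex.normSq_apply]
  ring

/-- The derivative of the Hopf map at `φ` in the direction `v`. -/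
noncomputable def dHopf (φ v : C2) : R3 :=
  !₂[2 * (star (φ 0) * v 1 + star (v 0) * φ 1).re, 2 * (star (φ 0) * v 1 + star (v 0) * φ 1).im,
    2 * (star (φ 0) * v 0 - star (φ 1) * v 1).re]

theorem dHopf_zero (φ v : C2) : dHopf φ v 0 =
    2 * ((φ 0).re * (v 1).re + (φ 0).im * (v 1).im + ((v 0).re * (φ 1).re + (v 0).im * (φ 1).im)) := by
  simp [dHopf]

theorem dHopf_one (φ v : C2) : dHopf φ v 1 =
    2 * ((φ 0).re * (v 1).im - (φ 0).im * (v 1).re + ((v 0).re * (φ 1).im - (v 0).im * (φ 1).re)) := by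
  simp [dHopf]
  ring

theorem dHopf_two (φ v : C2) : dHopf φ v 2 =
    2 * ((φ 0).re * (v 0).re + (φ 0).im * (v 0).im - ((φ 1).re * (v 1).re + (φ 1).im * (v 1).im)) := by
  simp [dHopf]

/-- The action on `ℂ²` of the Hermitian matrix `y₁σ₁ + y₂σ₂ + y₃σ₃`. -/
noncomputable def pauli (y : R3) (φ : C2) : C2 :=
  !₂[y 2 * φ 0 + (y 0 - Complex.I * y 1) * φ 1, (y 0 + Complex.I * y 1) * φ 0 - y 2 * φ 1]

theorem pauli_zero_re (y : R3) (φ : C2) :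
    (pauli y φ 0).re = y 2 * (φ 0).re + (y 0 * (φ 1).re + y 1 * (φ 1).im) := by
  simp [pauli]

theorem pauli_zero_im (y : R3) (φ : C2) :
    (pauli y φ 0).im = y 2 * (φ 0).im + (y 0 * (φ 1).im - y 1 * (φ 1).re) := by
  simp [pauli]
  ring

theorem pauli_one_re (y : R3) (φ : C2) :
    (pauli y φ 1).re = y 0 * (φ 0).re - y 1 * (φ 0).im - y 2 * (φ 1).re := by
  simp [pauli]

theorem pauli_one_im (y : R3) (φ : C2) :
    (pauli y φ 1).im = y 0 * (φ 0).im + y 1 * (φ 0).re - y 2 * (φ 1).im := by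
  simp [pauli]

theorem hopf_add_smul (φ v : C2) (t : ℝ) :
    hopf (φ + t • v) = hopf φ + t • dHopf φ v + t ^ 2 • hopf v := by
  refine R3_ext ?_ ?_ ?_ <;>
  simp [hopf_zero, hopf_one, hopf_two, dHopf_zero, dHopf_one, dHopf_two] <;> ring

theorem hopf_smul (c : ℂ) (φ : C2) : hopf (c • φ) = (‖c‖ ^ 2) • hopf φ := by
  refine R3_ext ?_ ?_ ?_ <;>
  simp [hopf_zero, hopf_one, hopf_two, Complex.sq_norm, Complex.normSq_apply] <;> ring

theorem hopf_real_smul (c : ℝ) (φ : C2) : hopf (c • φ) = c ^ 2 • hopf φ := by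
  refine R3_ext ?_ ?_ ?_ <;>
  simp [hopf_zero, hopf_one, hopf_two] <;> ring

theorem norm_hopf_sq (φ : C2) : ‖hopf φ‖ ^ 2 = (‖φ‖ ^ 2) ^ 2 := by
  rw [norm_sq_R3, norm_sq_C2, hopf_zero, hopf_one, hopf_two]
  ring

theorem norm_hopf (φ : C2) : ‖hopf φ‖ = ‖φ‖ ^ 2 :=
  (sq_eq_sq₀ (norm_nonneg _) (sq_nonneg _)).1 (norm_hopf_sq φ)

/-- This is tr(φφ*ψψ*) with φφ* = ½(‖φ‖² + h(φ)·σ) and likewise for ψ, using tr(σₐσ_b) = 2δₐ_b. -/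
theorem norm_inner_sq (φ ψ : C2) :
    2 * ‖inner ℂ φ ψ‖ ^ 2 = ‖φ‖ ^ 2 * ‖ψ‖ ^ 2 + inner ℝ (hopf φ) (hopf ψ) := by
  rw [Complex.sq_norm, Complex.normSq_apply, re_inner_C2, im_inner_C2, real_inner_C2, norm_sq_C2,
    norm_sq_C2, inner_R3]
  simp only [hopf_zero, hopf_one, hopf_two]
  ring

theorem inner_pauli_self (y : R3) (φ : C2) : inner ℝ φ (pauli y φ) = inner ℝ y (hopf φ) := by
  rw [real_inner_C2, inner_R3]
  simp only [hopf_zero, hopf_one, hopf_two, pauli_zero_re, pauli_zero_im, pauli_one_re,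
    pauli_one_im]
  ring

theorem norm_pauli_sq (y : R3) (φ : C2) : ‖pauli y φ‖ ^ 2 = ‖y‖ ^ 2 * ‖φ‖ ^ 2 := by
  rw [norm_sq_C2, norm_sq_C2, norm_sq_R3]
  simp only [pauli_zero_re, pauli_zero_im, pauli_one_re, pauli_one_im]
  ring

/-- From the anticommutator σₐ(y·σ) + (y·σ)σₐ = 2yₐ. Up to the scalar, (y·σ)φ is therefore a lift of
y through the Hopf map. -/
theorem dHopf_pauli (y : R3) (φ : C2) : dHopf φ (pauli y φ) = (2 * ‖φ‖ ^ 2) • y := by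
  refine R3_ext ?_ ?_ ?_ <;>
  simp only [dHopf_zero, dHopf_one, dHopf_two, pauli_zero_re, pauli_zero_im, pauli_one_re,
    pauli_one_im, PiLp.smul_apply, smul_eq_mul, norm_sq_C2] <;> ring

/-- From (y·σ)σ(y·σ) = 2y(y·σ) - ‖y‖²σ; for a unit vector y this is the half-turn about y. -/
theorem hopf_pauli (y : R3) (φ : C2) :
    hopf (pauli y φ) = (2 * inner ℝ y (hopf φ)) • y - ‖y‖ ^ 2 • hopf φ := by
  refine R3_ext ?_ ?_ ?_ <;>
  simp only [PiLp.sub_apply, hopf_zero, hopf_one, hopf_two, pauli_zero_re, pauli_zero_im,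
    pauli_one_re, pauli_one_im, PiLp.smul_apply, smul_eq_mul, norm_sq_R3, inner_R3] <;> ring

theorem pauli_hopf_self (φ : C2) : pauli (hopf φ) φ = ‖φ‖ ^ 2 • φ := by
  refine C2_ext ?_ ?_ ?_ ?_ <;>
  simp only [hopf_zero, hopf_one, hopf_two, pauli_zero_re, pauli_zero_im, pauli_one_re,
    pauli_one_im, PiLp.smul_apply, Complex.smul_re, Complex.smul_im, smul_eq_mul, norm_sq_C2] <;>
  ring

/-- The Hopf map intertwines the rotation about `y` with the flow of `-i/2 (y·σ)`. -/
theorem dHopf_I_pauli (y : R3) (φ : C2) :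
    dHopf φ ((-(Complex.I / 2)) • pauli y φ) = cross3 y (hopf φ) := by
  refine R3_ext ?_ ?_ ?_ <;>
  simp [dHopf_zero, dHopf_one, dHopf_two, pauli_zero_re, pauli_zero_im, pauli_one_re,
    pauli_one_im, cross3_zero, cross3_one, cross3_two, hopf_zero, hopf_one, hopf_two] <;> ring

/-- The projection to the line spanned by `ψ`, in terms of the Hopf map. -/
theorem two_inner_smul (φ ψ : C2) :
    (2 : ℂ) • (inner ℂ ψ φ • ψ) = ‖ψ‖ ^ 2 • φ + pauli (hopf ψ) φ := by
  refine C2_ext ?_ ?_ ?_ ?_ <;>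
  simp only [PiLp.add_apply, PiLp.smul_apply, smul_eq_mul, Complex.smul_re, Complex.smul_im,
    Complex.add_re, Complex.add_im, Complex.mul_re, Complex.mul_im, Complex.re_ofNat,
    Complex.im_ofNat, hopf_zero, hopf_one, hopf_two, pauli_zero_re, pauli_zero_im, pauli_one_re,
    pauli_one_im, re_inner_C2, im_inner_C2, real_inner_C2, norm_sq_C2] <;> ring

/-- Half the derivative of ‖h(φ)‖² = ‖φ‖⁴; hence vectors tangent to the three-sphere go to vectors
tangent to the two-sphere. -/
theorem inner_hopf_dHopf (φ v : C2) :
    inner ℝ (hopf φ) (dHopf φ v) = 2 * ‖φ‖ ^ 2 * inner ℝ φ v := by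
  rw [inner_R3, real_inner_C2, norm_sq_C2]
  simp only [hopf_zero, hopf_one, hopf_two, dHopf_zero, dHopf_one, dHopf_two]
  ring

/-- The pull-back of the area form, up to its constant. The correction in the inner bracket vanishes
when `v` and `w` are real-orthogonal to `φ`, leaving a multiple of the standard symplectic form. -/
theorem inner_hopf_cross3_dHopf (φ v w : C2) :
    inner ℝ (hopf φ) (cross3 (dHopf φ v) (dHopf φ w)) =
      4 * ‖φ‖ ^ 2 * (‖φ‖ ^ 2 * (inner ℂ v w).im -
        (inner ℝ φ v * (inner ℂ φ w).im - (inner ℂ φ v).im * inner ℝ φ w)) := by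
  rw [inner_R3]
  simp only [cross3_zero, cross3_one, cross3_two, hopf_zero, hopf_one, hopf_two, dHopf_zero,
    dHopf_one, dHopf_two, real_inner_C2, im_inner_C2, norm_sq_C2]
  ring

theorem dHopf_real_smul (φ v : C2) (c : ℝ) : dHopf φ (c • v) = c • dHopf φ v := by
  refine R3_ext ?_ ?_ ?_ <;> simp [dHopf_zero, dHopf_one, dHopf_two] <;> ring

/-! ### Vector algebra in `ℝ³` -/

theorem inner_cross3_triple (x y w : R3) :
    inner ℝ x (cross3 (cross3 y x) w) = ‖x‖ ^ 2 * inner ℝ y w - inner ℝ x y * inner ℝ x w := by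
  simp only [inner_R3, cross3_zero, cross3_one, cross3_two, norm_sq_R3]
  ring

theorem inner_cross3_cross3_right (x v : R3) :
    inner ℝ x (cross3 v (cross3 x v)) = ‖x‖ ^ 2 * ‖v‖ ^ 2 - inner ℝ x v ^ 2 := by
  simp only [inner_R3, cross3_zero, cross3_one, cross3_two, norm_sq_R3]
  ring

theorem inner_cross3_right_self (x y : R3) : inner ℝ x (cross3 y x) = 0 := by
  simp only [inner_R3, cross3_zero, cross3_one, cross3_two]
  ring

theorem inner_cross3_left_self (x y : R3) : inner ℝ x (cross3 x y) = 0 := by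
  simp only [inner_R3, cross3_zero, cross3_one, cross3_two]
  ring

/-- Three vectors orthogonal to a nonzero vector of `ℝ³` are linearly dependent. -/
theorem inner_cross3_eq_zero_of_orthogonal {x u v w : R3} (hx : x ≠ 0) (hu : inner ℝ x u = 0)
    (hv : inner ℝ x v = 0) (hw : inner ℝ x w = 0) : inner ℝ u (cross3 v w) = 0 := by
  have h : ‖x‖ ^ 2 * inner ℝ u (cross3 v w) =
      inner ℝ x u * inner ℝ x (cross3 v w) + inner ℝ x v * inner ℝ x (cross3 w u)
        + inner ℝ x w * inner ℝ x (cross3 u v) := by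
    simp only [inner_R3, cross3_zero, cross3_one, cross3_two, norm_sq_R3]
    ring
  rw [hu, hv, hw] at h
  simpa [hx] using h

theorem norm_sub_sq_of_mem_sphere {R : ℝ} {x y : R3} (hx : ‖x‖ = R) (hy : ‖y‖ = R) :
    ‖x - y‖ ^ 2 = 2 * (R ^ 2 - inner ℝ x y) := by
  rw [norm_sub_sq_real, hx, hy]
  ring

/-! ### The Hopf map as a circle bundle -/

theorem contDiff_hopf : ContDiff ℝ ∞ hopf := by
  have hre : ∀ k, ContDiff ℝ ∞ fun φ : C2 => (φ k).re := fun k =>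
    Complex.reCLM.contDiff.comp (PiLp.proj (𝕜 := ℝ) 2 (fun _ : Fin 2 => ℂ) k).contDiff
  have him : ∀ k, ContDiff ℝ ∞ fun φ : C2 => (φ k).im := fun k =>
    Complex.imCLM.contDiff.comp (PiLp.proj (𝕜 := ℝ) 2 (fun _ : Fin 2 => ℂ) k).contDiff
  refine contDiff_euclidean.2 fun k => ?_
  fin_cases k
  · simp only [Fin.zero_eta, hopf_zero]
    exact contDiff_const.mul (((hre 0).mul (hre 1)).add ((him 0).mul (him 1)))
  · simp only [Fin.mk_one, hopf_one]
    exact contDiff_const.mul (((hre 0).mul (him 1)).sub ((him 0).mul (hre 1)))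
  · simp only [Fin.reduceFinMk, hopf_two]
    exact (((hre 0).pow 2).add ((him 0).pow 2)).sub (((hre 1).pow 2).add ((him 1).pow 2))

theorem contDiff_hopfN {N : ℕ} : ContDiff ℝ ∞ (hopfN : PhaseSpace N → Fin N → R3) :=
  contDiff_pi.2 fun i => contDiff_hopf.comp (contDiff_apply ℝ C2 i)

theorem fderiv_hopfN_apply {N : ℕ} (φ v : PhaseSpace N) :
    fderiv ℝ hopfN φ v = fun i => dHopf (φ i) (v i) := by
  refine fderiv_apply_of_quadratic (b := hopfN v) (contDiff_hopfN.differentiable (by simp) φ)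
    fun t => ?_
  ext1 i
  exact hopf_add_smul (φ i) (v i) t

/-- By `norm_inner_sq`, equal Hopf images force |φ*ψ| = R = ‖φ‖‖ψ‖. So ψ equals its projection to
the line of φ, and the phase is φ*ψ / R. -/
theorem exists_circle_smul_of_hopf_eq {R : ℝ} (hR : 0 < R) {φ ψ : C2} (hφ : ‖φ‖ ^ 2 = R)
    (h : hopf φ = hopf ψ) : ∃ g : Circle, ψ = g • φ := by
  have hψ : ‖ψ‖ ^ 2 = R := by rw [← norm_hopf, ← h, norm_hopf, hφ]
  have hn : ‖inner ℂ φ ψ‖ = R := by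
    have h1 := norm_inner_sq φ ψ
    rw [← h, real_inner_self_eq_norm_sq, norm_hopf, hφ, hψ] at h1
    exact (sq_eq_sq₀ (norm_nonneg _) hR.le).1 (by linarith)
  have h2 : (2 : ℝ) • (R • ψ) = (2 : ℝ) • (inner ℂ φ ψ • φ) := by
    have h1 := two_inner_smul ψ φ
    rw [h, pauli_hopf_self, hφ, hψ] at h1
    rw [two_smul ℝ, two_smul ℝ, ← h1, two_smul ℂ]
  have h3 : R • ψ = inner ℂ φ ψ • φ := smul_right_injective _ two_ne_zero h2
  have h4 : ‖(R : ℂ)⁻¹ * inner ℂ φ ψ‖ = 1 := by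
    rw [norm_mul, hn, norm_inv, Complex.norm_real, Real.norm_of_nonneg hR.le,
      inv_mul_cancel₀ hR.ne']
  obtain ⟨g, hg⟩ : ∃ g : Circle, (g : ℂ) = (R : ℂ)⁻¹ * inner ℂ φ ψ :=
    ⟨⟨_, mem_sphere_zero_iff_norm.2 h4⟩, rfl⟩
  exact ⟨g, by rw [Circle.smul_def, hg, mul_smul, ← h3, ← Complex.ofReal_inv, Complex.coe_smul,
    inv_smul_smul₀ hR.ne']⟩

theorem hopf_circle_smul (g : Circle) (φ : C2) : hopf (g • φ) = hopf φ := by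
  rw [Circle.smul_def, hopf_smul, Circle.norm_coe, one_pow, one_smul]

/-- The section of the Hopf map over the complement of the antipode of `hopf p`, through `p`. -/
noncomputable def hopfSection (R : ℝ) (p : C2) (y : R3) : C2 :=
  (√(2 * (R ^ 2 + inner ℝ y (hopf p))))⁻¹ • (R • p + pauli y p)

/-- For ‖y‖ = R the matrix R + y·σ is 2R times the projection to the line over y, so its value at p,
once normalized, lies in the fibre over y. This norm is the normalizing factor; for R > 0 it
vanishes only if y = -h(p). -/
theorem norm_hopfSection_aux {R : ℝ} {p : C2} {y : R3} (hp : ‖p‖ ^ 2 = R) (hy : ‖y‖ = R) :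
    ‖R • p + pauli y p‖ ^ 2 = 2 * (R ^ 2 + inner ℝ y (hopf p)) * R := by
  rw [norm_add_sq_real, inner_smul_left, inner_pauli_self, norm_pauli_sq, norm_smul, mul_pow, hp,
    hy, Real.norm_eq_abs, sq_abs]
  simp
  ring

theorem hopf_hopfSection_aux {R : ℝ} {p : C2} {y : R3} (hp : ‖p‖ ^ 2 = R) (hy : ‖y‖ = R) :
    hopf (R • p + pauli y p) = (2 * (R ^ 2 + inner ℝ y (hopf p))) • y := by
  have h := hopf_add_smul (pauli y p) p R
  -- `dHopf` is the polarization of the quadratic map `hopf`, hence symmetric, so `dHopf_pauli`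
  -- applies.
  have h1 : dHopf (pauli y p) p = dHopf p (pauli y p) := by
    refine R3_ext ?_ ?_ ?_ <;> simp only [dHopf_zero, dHopf_one, dHopf_two] <;> ring
  rw [add_comm, h, h1, dHopf_pauli, hopf_pauli, hp, hy]
  module

theorem norm_hopfSection {R : ℝ} {p : C2} {y : R3} (hp : ‖p‖ ^ 2 = R) (hy : ‖y‖ = R)
    (hpos : 0 < R ^ 2 + inner ℝ y (hopf p)) : ‖hopfSection R p y‖ ^ 2 = R := by
  have h2 : 0 < 2 * (R ^ 2 + inner ℝ y (hopf p)) := by positivity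
  rw [hopfSection, norm_smul, mul_pow, norm_hopfSection_aux hp hy, Real.norm_eq_abs, sq_abs,
    inv_pow, Real.sq_sqrt h2.le]
  field_simp

theorem hopf_hopfSection {R : ℝ} {p : C2} {y : R3} (hp : ‖p‖ ^ 2 = R) (hy : ‖y‖ = R)
    (hpos : 0 < R ^ 2 + inner ℝ y (hopf p)) : hopf (hopfSection R p y) = y := by
  have h2 : 0 < 2 * (R ^ 2 + inner ℝ y (hopf p)) := by positivity
  rw [hopfSection, hopf_real_smul, hopf_hopfSection_aux hp hy, inv_pow, Real.sq_sqrt h2.le,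
    inv_smul_smul₀ h2.ne']

theorem hopfSection_self {R : ℝ} (hR : 0 < R) {p : C2} (hp : ‖p‖ ^ 2 = R) :
    hopfSection R p (hopf p) = p := by
  have h : √(2 * (R ^ 2 + inner ℝ (hopf p) (hopf p))) = 2 * R := by
    rw [real_inner_self_eq_norm_sq, norm_hopf, hp, ← Real.sqrt_sq (by positivity : 0 ≤ 2 * R)]
    ring_nf
  rw [hopfSection, h, pauli_hopf_self, hp, ← two_smul ℝ (R • p), smul_smul (2 : ℝ), inv_smul_smul₀]
  positivity

theorem contDiff_pauli_left (p : C2) : ContDiff ℝ ∞ fun y : R3 => pauli y p := by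
  have hy : ∀ k, ContDiff ℝ ∞ fun y : R3 => (y k : ℂ) := fun k =>
    Complex.ofRealCLM.contDiff.comp (PiLp.proj (𝕜 := ℝ) 2 (fun _ : Fin 3 => ℝ) k).contDiff
  refine (contDiff_piLp (𝕜 := ℝ) 2).2 fun k => ?_
  fin_cases k
  · simp only [pauli, Fin.zero_eta, PiLp.toLp_apply, Matrix.cons_val_zero]
    exact ((hy 2).mul contDiff_const).add
      (((hy 0).sub (contDiff_const.mul (hy 1))).mul contDiff_const)
  · simp only [pauli, Fin.mk_one, PiLp.toLp_apply, Matrix.cons_val_one]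
    exact (((hy 0).add (contDiff_const.mul (hy 1))).mul contDiff_const).sub
      ((hy 2).mul contDiff_const)

theorem contDiffOn_hopfSection (R : ℝ) (p : C2) :
    ContDiffOn ℝ ∞ (hopfSection R p) {y | 0 < R ^ 2 + inner ℝ y (hopf p)} := by
  have hlin : ContDiff ℝ ∞ fun y : R3 => 2 * (R ^ 2 + inner ℝ y (hopf p)) :=
    contDiff_const.mul (contDiff_const.add (contDiff_id.inner ℝ contDiff_const))
  refine ContDiffOn.smul (ContDiffOn.inv (hlin.contDiffOn.sqrt fun y hy => ?_) fun y hy => ?_)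
    (contDiff_const.add (contDiff_pauli_left p)).contDiffOn
  · have : 0 < R ^ 2 + inner ℝ y (hopf p) := hy
    positivity
  · have : 0 < R ^ 2 + inner ℝ y (hopf p) := hy
    positivity

theorem isOpen_hopfSection_domain (R : ℝ) (p : C2) :
    IsOpen {y : R3 | 0 < R ^ 2 + inner ℝ y (hopf p)} :=
  isOpen_lt continuous_const (by fun_prop)

theorem hopf_mem_hopfSection_domain {R : ℝ} (hR : 0 < R) (p : C2) :
    0 < R ^ 2 + inner ℝ (hopf p) (hopf p) :=
  add_pos_of_pos_of_nonneg (by positivity) real_inner_self_nonneg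

theorem exists_hopf_eq {R : ℝ} (hR : 0 < R) {y : R3} (hy : ‖y‖ = R) :
    ∃ p : C2, ‖p‖ ^ 2 = R ∧ hopf p = y := by
  obtain ⟨p, hp, hpos⟩ : ∃ p : C2, ‖p‖ ^ 2 = R ∧ 0 < R ^ 2 + inner ℝ y (hopf p) := by
    -- The sections based over the north and south poles suffice: each is defined on the closed
    -- hemisphere around its own pole, and these cover the sphere.
    rcases le_total 0 (y 2) with h | h
    · refine ⟨!₂[(√R : ℂ), 0], ?_, ?_⟩
      · simp [norm_sq_C2, hR.le]
      · simp [inner_R3, hopf_zero, hopf_one, hopf_two, hR.le]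
        positivity
    · refine ⟨!₂[0, (√R : ℂ)], ?_, ?_⟩
      · simp [norm_sq_C2, hR.le]
      · simp [inner_R3, hopf_zero, hopf_one, hopf_two, hR.le]
        nlinarith
  exact ⟨_, norm_hopfSection hp hy hpos, hopf_hopfSection hp hy hpos⟩

/-! ### The Marsden–Weinstein quotient -/

theorem exists_isAlt_bilinear {V : Type*} [AddCommGroup V] [Module ℝ V] {f : V → V → ℝ}
    (hadd : ∀ v v' w, f (v + v') w = f v w + f v' w) (hsmul : ∀ (c : ℝ) v w, f (c • v) w = c * f v w)
    (hskew : ∀ v w, f v w = -f w v) :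
    ∃ B : V →ₗ[ℝ] V →ₗ[ℝ] ℝ, B.IsAlt ∧ ∀ v w, f v w = B v w := by
  refine ⟨LinearMap.mk₂ ℝ f hadd hsmul (fun v w w' => ?_) (fun c v w => ?_), fun v => ?_,
    fun _ _ => rfl⟩
  · rw [hskew, hadd, hskew v w, hskew v w']
    ring
  · rw [hskew, hsmul, hskew v w, smul_eq_mul]
    ring
  · have := hskew v v
    rw [LinearMap.mk₂_apply]
    linarith

/-! ### The level set, the symplectic form and the torus action on the phase space -/

section Momentum

variable {N : ℕ} {R : ℝ} {Γ : Fin N → ℝ}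

theorem mem_momentumLevel_iff (hR : 0 < R) (hΓ : ∀ i, Γ i ≠ 0) {φ : PhaseSpace N} :
    φ ∈ momentumMap R Γ ⁻¹' {fun i => -2 * Γ i} ↔ ∀ i, ‖φ i‖ ^ 2 = R := by
  rw [mem_preimage, mem_singleton_iff, funext_iff]
  refine forall_congr' fun i => ?_
  have := hΓ i
  rw [momentumMap]
  constructor
  · intro h
    field_simp at h
    linarith
  · intro h
    rw [h]
    field_simp

theorem mem_sphere_sqrt_iff (hR : 0 < R) {ψ : C2} :
    ψ ∈ Metric.sphere (0 : C2) √R ↔ ‖ψ‖ ^ 2 = R := by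
  rw [mem_sphere_zero_iff_norm, ← sq_eq_sq₀ (norm_nonneg _) (Real.sqrt_nonneg _), Real.sq_sqrt hR.le]

theorem momentumLevel_eq_piSphere (hR : 0 < R) (hΓ : ∀ i, Γ i ≠ 0) :
    momentumMap R Γ ⁻¹' {fun i => -2 * Γ i}
      = {φ : PhaseSpace N | ∀ i, φ i ∈ Metric.sphere (0 : C2) √R} := by
  ext φ
  rw [mem_momentumLevel_iff hR hΓ, mem_ofPred_eq]
  exact forall_congr' fun i => (mem_sphere_sqrt_iff hR).symm

theorem mem_tangentVectors_momentumLevel (hR : 0 < R) (hΓ : ∀ i, Γ i ≠ 0) {φ v : PhaseSpace N}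
    (hφ : φ ∈ momentumMap R Γ ⁻¹' {fun i => -2 * Γ i}) :
    v ∈ tangentVectors (momentumMap R Γ ⁻¹' {fun i => -2 * Γ i}) φ ↔
      ∀ i, inner ℝ (φ i) (v i) = 0 := by
  rw [momentumLevel_eq_piSphere hR hΓ] at hφ ⊢
  exact mem_tangentVectors_piSphere (Real.sqrt_pos.2 hR) hφ

theorem mem_tangentVectors_sphereProduct (hR : 0 < R) {x v : Fin N → R3}
    (hx : x ∈ sphereProduct N R) :
    v ∈ tangentVectors (sphereProduct N R) x ↔ ∀ i, inner ℝ (x i) (v i) = 0 :=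
  mem_tangentVectors_piSphere hR hx

theorem liftedTheta_add_smul (φ v w : PhaseSpace N) (t : ℝ) :
    liftedTheta R Γ (φ + t • v) w = liftedTheta R Γ φ w + t * liftedTheta R Γ v w := by
  simp only [liftedTheta, Finset.mul_sum, ← Finset.sum_add_distrib]
  refine Finset.sum_congr rfl fun i _ => ?_
  simp [im_inner_C2]
  ring

theorem contDiff_im_inner (i : Fin N) (w : C2) :
    ContDiff ℝ ∞ fun φ : PhaseSpace N => (inner ℂ (φ i) w).im :=
  Complex.imCLM.contDiff.comp ((contDiff_apply ℝ C2 i).inner ℂ contDiff_const)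

theorem contDiff_liftedTheta (w : PhaseSpace N) : ContDiff ℝ ∞ fun φ => liftedTheta R Γ φ w :=
  contDiff_const.mul (ContDiff.sum fun i _ => contDiff_const.mul (contDiff_im_inner i (w i)))

theorem fderiv_liftedTheta (φ v w : PhaseSpace N) :
    fderiv ℝ (fun q => liftedTheta R Γ q w) φ v = liftedTheta R Γ v w :=
  fderiv_apply_of_quadratic (b := 0) ((contDiff_liftedTheta w).differentiable (by simp) φ)
    fun t => by simp [liftedTheta_add_smul]

/-- Θ is linear in the base point, so dΘ(v, w) = Θ_v(w) - Θ_w(v). The antisymmetry of Im v*w doubles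
2/R to 4/R, and the form has constant coefficients. -/
theorem liftedOmega_apply (φ v w : PhaseSpace N) :
    liftedOmega R Γ φ v w = 4 / R * ∑ i, Γ i * (inner ℂ (v i) (w i)).im := by
  rw [liftedOmega, extDerivOne, fderiv_liftedTheta, fderiv_liftedTheta, liftedTheta, liftedTheta,
    ← mul_sub, ← Finset.sum_sub_distrib, Finset.mul_sum, Finset.mul_sum, ← Finset.sum_neg_distrib]
  refine Finset.sum_congr rfl fun i _ => ?_
  rw [im_inner_C2, im_inner_C2]
  ring

theorem im_inner_I_smul (φ w : C2) : (inner ℂ (Complex.I • φ) w).im = -inner ℝ φ w := by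
  rw [im_inner_C2, real_inner_C2]
  simp
  ring

theorem im_inner_eq_real_inner (φ w : C2) : (inner ℂ φ w).im = inner ℝ (Complex.I • φ) w := by
  rw [im_inner_C2, real_inner_C2]
  simp
  ring

theorem isSymplecticOn_liftedOmega (hR : 0 < R) (hΓ : ∀ i, Γ i ≠ 0) :
    IsSymplecticOn univ (liftedOmega R Γ) where
  smooth v w := by
    simp only [liftedOmega_apply]
    exact contDiff_const
  alternating p := by
    refine exists_isAlt_bilinear (fun v v' w => ?_) (fun c v w => ?_) (fun v w => ?_) <;>
    simp only [liftedOmega_apply, Pi.add_apply, Pi.smul_apply, im_inner_C2, Finset.mul_sum,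
      ← Finset.sum_add_distrib, ← Finset.sum_neg_distrib, PiLp.add_apply, PiLp.smul_apply,
      Complex.add_re, Complex.add_im, Complex.smul_re, Complex.smul_im, smul_eq_mul] <;>
    exact Finset.sum_congr rfl fun i _ => by ring
  closed p _ u _ v _ w _ := by
    simp [extDerivTwo, liftedOmega_apply]
  nondegenerate p _ v _ h := by
    ext1 i
    -- Tested on `Complex.I • v i` in the slot `i`, the form gives a nonzero multiple of `‖v i‖ ^
    -- 2`.
    have h1 := h (Pi.single i (Complex.I • v i)) (mem_tangentVectors_univ _ _)
    rw [liftedOmega_apply, Finset.sum_eq_single i] at h1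
    · have h2 : (inner ℂ (v i) (Complex.I • v i)).im = ‖v i‖ ^ 2 := by
        rw [im_inner_C2, norm_sq_C2]
        simp
        ring
      rw [Pi.single_eq_same, h2] at h1
      simpa [hR.ne', hΓ i] using h1
    · intro j _ hj
      simp [hj]
    · simp

theorem momentumMap_add_smul (φ v : PhaseSpace N) (t : ℝ) (i : Fin N) :
    momentumMap R Γ (φ + t • v) i = momentumMap R Γ φ i
      + t * (-(4 / R) * (Γ i * inner ℝ (φ i) (v i))) + t ^ 2 * momentumMap R Γ v i := by
  simp only [momentumMap, norm_sq_C2, real_inner_C2]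
  simp
  ring

theorem contDiff_momentumMap : ContDiff ℝ ∞ (momentumMap R Γ) :=
  contDiff_pi.2 fun i => contDiff_const.mul
    (contDiff_const.mul ((contDiff_apply ℝ C2 i).norm_sq ℝ))

theorem fderiv_momentumMap_apply (φ v : PhaseSpace N) :
    fderiv ℝ (momentumMap R Γ) φ v = fun i => -(4 / R) * (Γ i * inner ℝ (φ i) (v i)) := by
  refine fderiv_apply_of_quadratic (b := momentumMap R Γ v)
    (contDiff_momentumMap.differentiable (by simp) φ) fun t => ?_
  ext1 i
  exact momentumMap_add_smul φ v t i

theorem fderiv_momentumMap_pairing (ξ : Fin N → ℝ) (φ v : PhaseSpace N) :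
    fderiv ℝ (fun ψ => ∑ i, momentumMap R Γ ψ i * ξ i) φ v =
      ∑ i, -(4 / R) * (Γ i * inner ℝ (φ i) (v i)) * ξ i := by
  refine fderiv_apply_of_quadratic (b := ∑ i, momentumMap R Γ v i * ξ i) ?_ fun t => ?_
  · refine (ContDiff.sum fun i _ => ContDiff.mul ?_ contDiff_const).differentiable
      (n := ∞) (by simp) φ
    exact (contDiff_apply ℝ ℝ i).comp contDiff_momentumMap
  · simp only [momentumMap_add_smul, smul_eq_mul, Finset.mul_sum, ← Finset.sum_add_distrib]
    exact Finset.sum_congr rfl fun i _ => by ring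

theorem torusGenerator_apply (ξ : Fin N → ℝ) (φ : PhaseSpace N) :
    torusGenerator ξ φ = fun i => ξ i • (Complex.I • φ i) := by
  refine HasDerivAt.deriv (hasDerivAt_pi.2 fun i => ?_)
  have h1 : HasDerivAt (fun s : ℝ => ((s * ξ i : ℝ) : ℂ) * Complex.I) (ξ i * Complex.I) 0 := by
    have := ((hasDerivAt_id (0 : ℝ)).mul_const (ξ i)).ofReal_comp.mul_const Complex.I
    simpa using this
  have h2 := h1.cexp.smul_const (φ i)
  simp only [Pi.smul_apply', Circle.smul_def, Circle.coe_exp]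
  refine h2.congr_deriv ?_
  simp [mul_smul]

theorem norm_torus_smul (g : Torus N) (φ : PhaseSpace N) (i : Fin N) : ‖(g • φ) i‖ = ‖φ i‖ := by
  rw [Pi.smul_apply', Circle.smul_def, norm_smul, Circle.norm_coe, one_mul]

theorem inner_torus_smul (g : Torus N) (φ ψ : PhaseSpace N) (i : Fin N) :
    inner ℂ ((g • φ) i) ((g • ψ) i) = inner ℂ (φ i) (ψ i) := by
  have h : (starRingEnd ℂ) (g i : ℂ) * (g i : ℂ) = 1 := by
    rw [← Complex.normSq_eq_conj_mul_self, Circle.normSq_coe, Complex.ofReal_one]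
  simp only [Pi.smul_apply', Circle.smul_def, inner_smul_left, inner_smul_right]
  rw [← mul_assoc, mul_comm (g i : ℂ), h, one_mul]

theorem norm_inner_torus_smul (g : Torus N) (φ : PhaseSpace N) (i j : Fin N) :
    ‖inner ℂ ((g • φ) i) ((g • φ) j)‖ = ‖inner ℂ (φ i) (φ j)‖ := by
  simp only [Pi.smul_apply', Circle.smul_def, inner_smul_left, inner_smul_right, norm_mul,
    RCLike.norm_conj, Circle.norm_coe, one_mul]

theorem liftedHamiltonian_torus_smul (g : Torus N) (φ : PhaseSpace N) :
    liftedHamiltonian R Γ (g • φ) = liftedHamiltonian R Γ φ := by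
  simp only [liftedHamiltonian, liftedDistSq, norm_torus_smul, norm_inner_torus_smul]

end Momentum

/-! ### The reduced symplectic form on the product of two-spheres -/

section SphereProduct

variable {N : ℕ} {R : ℝ} {Γ : Fin N → ℝ}

theorem vortexForm_add_smul (x y v w : Fin N → R3) (t : ℝ) :
    vortexForm R Γ (x + t • y) v w = vortexForm R Γ x v w + t * vortexForm R Γ y v w := by
  simp only [vortexForm, areaForm, Finset.mul_sum, ← Finset.sum_add_distrib]
  refine Finset.sum_congr rfl fun i _ => ?_
  rw [Pi.add_apply, Pi.smul_apply, inner_add_left, real_inner_smul_left]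
  ring

theorem contDiff_vortexForm (v w : Fin N → R3) : ContDiff ℝ ∞ fun x => vortexForm R Γ x v w :=
  ContDiff.sum fun i _ => contDiff_const.mul (contDiff_const.mul
    ((contDiff_apply ℝ R3 i).inner ℝ contDiff_const))

theorem fderiv_vortexForm (c : ℝ) (x y v w : Fin N → R3) :
    fderiv ℝ (fun q => c * vortexForm R Γ q v w) x y = c * vortexForm R Γ y v w :=
  fderiv_apply_of_quadratic (b := 0)
    ((contDiff_const.mul (contDiff_vortexForm v w)).differentiable (n := ∞) (by simp) x)
    fun t => by
      simp [vortexForm_add_smul]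
      ring

theorem ne_zero_of_mem_sphereProduct (hR : 0 < R) {x : Fin N → R3} (hx : x ∈ sphereProduct N R)
    (i : Fin N) : x i ≠ 0 := by
  intro h
  have := mem_sphere_zero_iff_norm.1 (hx i)
  rw [h, norm_zero] at this
  exact hR.ne this

theorem vortexForm_eq_zero_of_orthogonal {x u v w : Fin N → R3} (hx : ∀ i, x i ≠ 0)
    (hu : ∀ i, inner ℝ (x i) (u i) = 0) (hv : ∀ i, inner ℝ (x i) (v i) = 0)
    (hw : ∀ i, inner ℝ (x i) (w i) = 0) : vortexForm R Γ u v w = 0 := by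
  refine Finset.sum_eq_zero fun i _ => ?_
  rw [areaForm, inner_cross3_eq_zero_of_orthogonal (hx i) (hu i) (hv i) (hw i)]
  ring

theorem isSymplecticOn_vortexForm (hR : 0 < R) (hΓ : ∀ i, Γ i ≠ 0) :
    IsSymplecticOn (sphereProduct N R) fun x v w => (R ^ 2)⁻¹ * vortexForm R Γ x v w where
  smooth v w := contDiff_const.mul (contDiff_vortexForm v w)
  alternating p := by
    refine exists_isAlt_bilinear (fun v v' w => ?_) (fun c v w => ?_) (fun v w => ?_) <;>
    simp only [vortexForm, areaForm, inner_R3, cross3_zero, cross3_one, cross3_two, Pi.add_apply,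
      Pi.smul_apply, Finset.mul_sum, ← Finset.sum_add_distrib, ← Finset.sum_neg_distrib,
      PiLp.add_apply, PiLp.smul_apply, smul_eq_mul] <;>
    exact Finset.sum_congr rfl fun i _ => by ring
  closed p hp u hu v hv w hw := by
    rw [mem_tangentVectors_sphereProduct hR hp] at hu hv hw
    have h0 := ne_zero_of_mem_sphereProduct hR hp
    -- The form is linear in the base point, so its exterior derivative is a sum of triple products
    -- of three tangent vectors. On each factor these lie in one plane, so every term vanishes.
    rw [extDerivTwo, fderiv_vortexForm, fderiv_vortexForm, fderiv_vortexForm,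
      vortexForm_eq_zero_of_orthogonal h0 hu hv hw, vortexForm_eq_zero_of_orthogonal h0 hv hu hw,
      vortexForm_eq_zero_of_orthogonal h0 hw hu hv]
    ring
  nondegenerate p hp v hv h := by
    rw [mem_tangentVectors_sphereProduct hR hp] at hv
    ext1 i
    -- Nondegeneracy is tested on `v i` rotated by a quarter turn in the tangent plane and scaled by
    -- R.
    have h1 := h (Pi.single i (cross3 (p i) (v i))) <|
      (mem_tangentVectors_sphereProduct hR hp).2 fun j => by
        rcases eq_or_ne j i with rfl | hj
        · rw [Pi.single_eq_same, inner_cross3_left_self]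
        · rw [Pi.single_eq_of_ne hj, inner_zero_right]
    rw [vortexForm, Finset.sum_eq_single i] at h1
    · have hi := mem_sphere_zero_iff_norm.1 (hp i)
      rw [Pi.single_eq_same, areaForm, inner_cross3_cross3_right, hv i, hi] at h1
      simpa [hR.ne', hΓ i] using h1
    · intro j _ hj
      rw [Pi.single_eq_of_ne hj]
      simp [areaForm, inner_R3, cross3_zero, cross3_one, cross3_two]
    · simp

end SphereProduct

/-! ### Reduction by the Hopf map -/

section Reduction

variable {N : ℕ} {R : ℝ} {Γ : Fin N → ℝ}

theorem exists_hopfN_eq (hR : 0 < R) {x : Fin N → R3} (hx : x ∈ sphereProduct N R) :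
    ∃ φ : PhaseSpace N, (∀ i, ‖φ i‖ ^ 2 = R) ∧ hopfN φ = x := by
  choose φ hφ hφx using fun i => exists_hopf_eq hR (mem_sphere_zero_iff_norm.1 (hx i))
  exact ⟨φ, hφ, funext hφx⟩

theorem hopfN_mem_sphereProduct {φ : PhaseSpace N} (hφ : ∀ i, ‖φ i‖ ^ 2 = R) :
    hopfN φ ∈ sphereProduct N R := fun i => by
  rw [mem_sphere_zero_iff_norm, hopfN, norm_hopf, hφ]

theorem hopfN_torus_smul (g : Torus N) (φ : PhaseSpace N) : hopfN (g • φ) = hopfN φ :=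
  funext fun i => hopf_circle_smul (g i) (φ i)

theorem hopfN_eq_iff (hR : 0 < R) {φ ψ : PhaseSpace N} (hφ : ∀ i, ‖φ i‖ ^ 2 = R) :
    hopfN φ = hopfN ψ ↔ ∃ g : Torus N, ψ = g • φ := by
  constructor
  · intro h
    choose g hg using fun i => exists_circle_smul_of_hopf_eq hR (hφ i) (congrFun h i)
    exact ⟨g, funext hg⟩
  · rintro ⟨g, rfl⟩
    exact (hopfN_torus_smul g φ).symm

theorem isMarsdenWeinsteinQuotient_hopfN (hR : 0 < R) (hΓ : ∀ i, Γ i ≠ 0) :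
    IsMarsdenWeinsteinQuotient (liftedOmega R Γ) (momentumMap R Γ) (fun i => -2 * Γ i)
      (sphereProduct N R) N (fun x v w => (R ^ 2)⁻¹ * vortexForm R Γ x v w) hopfN where
  symplectic := isSymplecticOn_liftedOmega hR hΓ
  invariant_form g φ v w := by simp only [liftedOmega_apply, inner_torus_smul]
  smooth_momentum := contDiff_momentumMap
  momentum ξ φ w := by
    rw [liftedOmega_apply, fderiv_momentumMap_pairing, torusGenerator_apply, Finset.mul_sum]
    refine Finset.sum_congr rfl fun i _ => ?_
    have h : (inner ℂ (ξ i • Complex.I • φ i) (w i)).im = -(ξ i * inner ℝ (φ i) (w i)) := by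
      rw [smul_comm, im_inner_I_smul, real_inner_smul_left]
    rw [h]
    ring
  invariant_momentum g φ := by
    ext1 i
    simp only [momentumMap, norm_torus_smul]
  regular φ hφ y := by
    rw [mem_momentumLevel_iff hR hΓ] at hφ
    -- On the level set the derivative of Jᵢ along `a • φ i` is `-(4 * Γ i) * a`, because ‖φᵢ‖² = R.
    refine ⟨fun i => (-(y i / (4 * Γ i))) • φ i, ?_⟩
    rw [fderiv_momentumMap_apply]
    ext1 i
    have := hΓ i
    rw [real_inner_smul_right, real_inner_self_eq_norm_sq, hφ i]
    field_simp
  free g φ hφ h := by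
    rw [mem_momentumLevel_iff hR hΓ] at hφ
    ext1 i
    have h1 : (g i : ℂ) • φ i = (1 : ℂ) • φ i := by
      rw [one_smul]
      exact congrFun h i
    have h2 : φ i ≠ 0 := fun h0 => by
      have := hφ i
      simp [h0] at this
      exact hR.ne this
    exact Circle.ext (smul_left_injective ℂ h2 h1)
  submanifold := isSubmanifoldOfCodim_piSphere hR
  symplectic_quotient := isSymplecticOn_vortexForm hR hΓ
  smooth := contDiff_hopfN
  image := by
    ext x
    constructor
    · rintro ⟨φ, hφ, rfl⟩
      exact hopfN_mem_sphereProduct ((mem_momentumLevel_iff hR hΓ).1 hφ)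
    · intro hx
      obtain ⟨φ, hφ, rfl⟩ := exists_hopfN_eq hR hx
      exact ⟨φ, (mem_momentumLevel_iff hR hΓ).2 hφ, rfl⟩
  fibres φ hφ ψ _ := hopfN_eq_iff hR ((mem_momentumLevel_iff hR hΓ).1 hφ)
  submersion φ hφ := by
    have hn := (mem_momentumLevel_iff hR hΓ).1 hφ
    ext w
    rw [mem_tangentVectors_sphereProduct hR (hopfN_mem_sphereProduct hn)]
    constructor
    · rintro ⟨v, hv, rfl⟩ i
      rw [mem_tangentVectors_momentumLevel hR hΓ hφ] at hv
      rw [fderiv_hopfN_apply, hopfN, inner_hopf_dHopf, hv i, mul_zero]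
    · intro hw
      -- The lift supplied by `dHopf_pauli` with ‖φᵢ‖² = R. It is tangent to the level set because
      -- ⟨φ, (w·σ)φ⟩ = w·h(φ) = 0.
      refine ⟨fun i => (2 * R)⁻¹ • pauli (w i) (φ i), ?_, ?_⟩
      · rw [mem_tangentVectors_momentumLevel hR hΓ hφ]
        intro i
        rw [real_inner_smul_right, inner_pauli_self, real_inner_comm]
        exact mul_eq_zero_of_right _ (hw i)
      · rw [fderiv_hopfN_apply]
        ext1 i
        rw [dHopf_real_smul, dHopf_pauli, hn i, inv_smul_smul₀]
        positivity
  pullback φ hφ v hv w hw := by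
    rw [mem_tangentVectors_momentumLevel hR hΓ hφ] at hv hw
    rw [mem_momentumLevel_iff hR hΓ] at hφ
    rw [liftedOmega_apply, fderiv_hopfN_apply, fderiv_hopfN_apply, vortexForm, Finset.mul_sum,
      Finset.mul_sum]
    refine Finset.sum_congr rfl fun i _ => ?_
    -- The constants agree: R⁻² · R⁻¹ · 4R · R = 4/R, the factor in `liftedOmega_apply`.
    rw [areaForm, hopfN, inner_hopf_cross3_dHopf, hφ i, hv i, hw i]
    field_simp
    ring

end Reduction

/-! ### The orbit spaces -/

/-- The induced map is a continuous bijection from a compact space to a Hausdorff one, so its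
inverse is continuous. -/
theorem exists_orbitSpace_homeomorph {V W G : Type*} [NormedAddCommGroup V] [NormedAddCommGroup W]
    [Group G] [MulAction G V] {L : SubMulAction G V} {P : Set W} {h : V → W} (hh : Continuous h)
    (hL : IsCompact (L : Set V)) (hLP : ∀ p ∈ L, h p ∈ P) (hsurj : ∀ y ∈ P, ∃ p ∈ L, h p = y)
    (hfib : ∀ p ∈ L, ∀ q ∈ L, h p = h q ↔ ∃ g : G, q = g • p) :
    ∃ Φ : OrbitSpace L ≃ₜ P, ∀ p : L, (Φ (toOrbit L p) : W) = h p := by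
  have hrel : ∀ p q : L, (MulAction.orbitRel G L) p q ↔ h p = h q := by
    intro p q
    rw [MulAction.orbitRel_apply, MulAction.mem_orbit_iff, eq_comm, hfib q q.2 p p.2]
    refine exists_congr fun g => ?_
    rw [← Subtype.coe_inj, SubMulAction.val_smul, eq_comm]
  let f : OrbitSpace L → P := Quotient.lift (fun p : L => (⟨h p, hLP p p.2⟩ : P))
    fun p q hpq => Subtype.ext ((hrel p q).1 hpq)
  have hf : Continuous f := Continuous.quotient_lift
    ((hh.comp continuous_subtype_val).subtype_mk _) _
  have hbij : Function.Bijective f := by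
    constructor
    · intro a b
      refine Quotient.inductionOn₂ a b fun p q hpq => ?_
      exact Quotient.sound ((hrel p q).2 (congrArg Subtype.val hpq))
    · rintro ⟨y, hy⟩
      obtain ⟨p, hp, rfl⟩ := hsurj y hy
      exact ⟨toOrbit L ⟨p, hp⟩, rfl⟩
  have : CompactSpace L := isCompact_iff_compactSpace.1 hL
  have : CompactSpace (OrbitSpace L) := Quotient.compactSpace
  exact ⟨Continuous.homeoOfEquivCompactToT2 (f := Equiv.ofBijective f hbij) hf, fun p => rfl⟩

section

variable {N : ℕ} {R : ℝ} {Γ : Fin N → ℝ}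

theorem mem_threeSphere_iff (hR : 0 < R) {ψ : C2} : ψ ∈ threeSphere R ↔ ‖ψ‖ ^ 2 = R :=
  mem_sphere_sqrt_iff hR

theorem exists_threeSphere_orbit_homeomorph (hR : 0 < R) :
    ∃ χ : OrbitSpace (threeSphere R) ≃ₜ Metric.sphere (0 : R3) R,
      ∀ ψ : threeSphere R, (χ (toOrbit (threeSphere R) ψ) : R3) = hopf ψ := by
  refine exists_orbitSpace_homeomorph contDiff_hopf.continuous (isCompact_sphere (0 : C2) √R)
    (fun p hp => ?_) (fun y hy => ?_) (fun p hp q _ => ⟨fun h => ?_, ?_⟩)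
  · rw [mem_sphere_zero_iff_norm, norm_hopf, (mem_threeSphere_iff hR).1 hp]
  · obtain ⟨p, hp, hpy⟩ := exists_hopf_eq hR (mem_sphere_zero_iff_norm.1 hy)
    exact ⟨p, (mem_threeSphere_iff hR).2 hp, hpy⟩
  · exact exists_circle_smul_of_hopf_eq hR ((mem_threeSphere_iff hR).1 hp) h
  · rintro ⟨g, rfl⟩
    exact (hopf_circle_smul g p).symm

theorem exists_momentumLevel_orbit_homeomorph (hR : 0 < R) (hΓ : ∀ i, Γ i ≠ 0) :
    ∃ Φ : OrbitSpace (momentumLevel R Γ) ≃ₜ sphereProduct N R,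
      ∀ φ : momentumLevel R Γ, (Φ (toOrbit (momentumLevel R Γ) φ) : Fin N → R3)
        = hopfN (φ : PhaseSpace N) := by
  refine exists_orbitSpace_homeomorph contDiff_hopfN.continuous ?_
    (fun p hp => ?_) (fun y hy => ?_) (fun p hp q _ => ?_)
  · change IsCompact (momentumMap R Γ ⁻¹' {fun i => -2 * Γ i})
    rw [momentumLevel_eq_piSphere hR hΓ]
    exact isCompact_piSphere _
  · exact hopfN_mem_sphereProduct ((mem_momentumLevel_iff hR hΓ).1 hp)
  · obtain ⟨p, hp, hpy⟩ := exists_hopfN_eq hR hy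
    exact ⟨p, (mem_momentumLevel_iff hR hΓ).2 hp, hpy⟩
  · exact hopfN_eq_iff hR ((mem_momentumLevel_iff hR hΓ).1 hp)

theorem isOrbitDiffeo_hopf (hR : 0 < R)
    (χ : OrbitSpace (threeSphere R) ≃ₜ Metric.sphere (0 : R3) R)
    (hχ : ∀ ψ : threeSphere R, (χ (toOrbit (threeSphere R) ψ) : R3) = hopf ψ) :
    IsOrbitDiffeo χ := by
  refine isOrbitDiffeo_of_localSections χ hopf contDiff_hopf hχ fun p => ?_
  have hp := (mem_threeSphere_iff hR).1 p.2
  refine ⟨_, isOpen_hopfSection_domain R p, hopf_mem_hopfSection_domain hR p, hopfSection R p,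
    contDiffOn_hopfSection R p, hopfSection_self hR hp, ?_⟩
  rintro y ⟨hy, hyR⟩
  rw [mem_sphere_zero_iff_norm] at hyR
  exact ⟨(mem_threeSphere_iff hR).2 (norm_hopfSection hp hyR hy), hopf_hopfSection hp hyR hy⟩

theorem isOrbitDiffeo_hopfN (hR : 0 < R) (hΓ : ∀ i, Γ i ≠ 0)
    (Φ : OrbitSpace (momentumLevel R Γ) ≃ₜ sphereProduct N R)
    (hΦ : ∀ φ : momentumLevel R Γ, (Φ (toOrbit (momentumLevel R Γ) φ) : Fin N → R3)
        = hopfN (φ : PhaseSpace N)) :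
    IsOrbitDiffeo Φ := by
  refine isOrbitDiffeo_of_localSections Φ hopfN contDiff_hopfN hΦ fun p => ?_
  have hp := (mem_momentumLevel_iff hR hΓ).1 p.2
  refine ⟨univ.pi fun i => {y : R3 | 0 < R ^ 2 + inner ℝ y (hopf ((p : PhaseSpace N) i))},
    isOpen_set_pi finite_univ fun i _ => isOpen_hopfSection_domain R _,
    fun i _ => hopf_mem_hopfSection_domain hR _,
    fun y i => hopfSection R ((p : PhaseSpace N) i) (y i), contDiffOn_pi.2 fun i => ?_,
    funext fun i => hopfSection_self hR (hp i), ?_⟩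
  · exact (contDiffOn_hopfSection R _).comp (contDiff_apply ℝ R3 i).contDiffOn
      fun y hy => hy i (mem_univ i)
  · rintro y ⟨hy, hyR⟩
    have hyR' := fun i => mem_sphere_zero_iff_norm.1 (hyR i)
    exact ⟨(mem_momentumLevel_iff hR hΓ).2 fun i =>
      norm_hopfSection (hp i) (hyR' i) (hy i (mem_univ i)),
      funext fun i => hopf_hopfSection (hp i) (hyR' i) (hy i (mem_univ i))⟩

/-- A product of subsets is the product of the corresponding subtypes. -/
def sphereProductHomeomorph (N : ℕ) (R : ℝ) :
    sphereProduct N R ≃ₜ (Fin N → Metric.sphere (0 : R3) R) where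
  toFun x i := ⟨(x : Fin N → R3) i, x.2 i⟩
  invFun y := ⟨fun i => y i, fun i => (y i).2⟩
  left_inv _ := rfl
  right_inv _ := rfl
  continuous_toFun := continuous_pi fun i =>
    ((continuous_apply i).comp continuous_subtype_val).subtype_mk _
  continuous_invFun := Continuous.subtype_mk
    (continuous_pi fun i => continuous_subtype_val.comp (continuous_apply i)) _

theorem orbitSpace_identifications (hR : 0 < R) (hΓ : ∀ i, Γ i ≠ 0) :
    ∃ (Ψ : OrbitSpace (momentumLevel R Γ) ≃ₜ (Fin N → OrbitSpace (threeSphere R)))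
        (χ : OrbitSpace (threeSphere R) ≃ₜ Metric.sphere (0 : R3) R)
        (Φ : OrbitSpace (momentumLevel R Γ) ≃ₜ sphereProduct N R),
      (∀ (φ : momentumLevel R Γ) (i : Fin N), ∃ h : (φ : PhaseSpace N) i ∈ threeSphere R,
        Ψ (toOrbit (momentumLevel R Γ) φ) i
          = toOrbit (threeSphere R) ⟨(φ : PhaseSpace N) i, h⟩) ∧
      (∀ ψ : threeSphere R, (χ (toOrbit (threeSphere R) ψ) : R3) = hopf ψ) ∧
      (∀ φ : momentumLevel R Γ,
        (Φ (toOrbit (momentumLevel R Γ) φ) : Fin N → R3) = hopfN (φ : PhaseSpace N)) ∧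
      (∀ q i, (Φ q : Fin N → R3) i = χ (Ψ q i)) ∧
      IsOrbitDiffeo χ ∧ IsOrbitDiffeo Φ := by
  obtain ⟨χ, hχ⟩ := exists_threeSphere_orbit_homeomorph hR
  obtain ⟨Φ, hΦ⟩ := exists_momentumLevel_orbit_homeomorph (N := N) hR hΓ
  -- Ψ is obtained by going down to the spheres with Φ and back up with χ⁻¹ on each factor, which
  -- avoids comparing a quotient of a product with a product of quotients.
  refine ⟨Φ.trans ((sphereProductHomeomorph N R).trans (Homeomorph.piCongrRight fun _ => χ.symm)),
    χ, Φ, fun φ i => ?_, hχ, hΦ, fun q i => ?_, isOrbitDiffeo_hopf hR χ hχ,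
    isOrbitDiffeo_hopfN hR hΓ Φ hΦ⟩
  · have hi := (mem_threeSphere_iff hR).2 ((mem_momentumLevel_iff hR hΓ).1 φ.2 i)
    refine ⟨hi, ?_⟩
    change χ.symm ⟨(Φ (toOrbit (momentumLevel R Γ) φ) : Fin N → R3) i, _⟩ = _
    rw [Homeomorph.symm_apply_eq]
    exact Subtype.ext ((congrFun (hΦ φ) i).trans (hχ ⟨_, hi⟩).symm)
  · change (Φ q : Fin N → R3) i = χ (χ.symm ⟨(Φ q : Fin N → R3) i, _⟩)
    rw [Homeomorph.apply_symm_apply]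

end

/-! ### Dynamics -/

/-- Functions which agree on a subset have the same derivative along its tangent vectors. -/
theorem fderiv_eq_of_eqOn_of_mem_tangentVectors {V W : Type*} [NormedAddCommGroup V]
    [NormedSpace ℝ V] [NormedAddCommGroup W] [NormedSpace ℝ W] {f g : V → W} {A : Set V} {p v : V}
    (hf : DifferentiableAt ℝ f p) (hg : DifferentiableAt ℝ g p) (hfg : EqOn f g A)
    (hv : v ∈ tangentVectors A p) : fderiv ℝ f p v = fderiv ℝ g p v := by
  obtain ⟨ε, hε, γ, -, hγA, rfl, hγ⟩ := hv
  refine (hf.hasFDerivAt.comp_hasDerivAt (0 : ℝ) hγ).unique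
    ((hg.hasFDerivAt.comp_hasDerivAt (0 : ℝ) hγ).congr_of_eventuallyEq ?_)
  filter_upwards [Ioo_mem_nhds (neg_lt_zero.2 hε) hε] with t ht
  exact hfg (hγA t ht)

section Dynamics

variable {N : ℕ} {R : ℝ} {Γ : Fin N → ℝ}

/-- The vortex Hamiltonian in terms of chordal distances, on `(ℝ³)ᴺ`. -/
noncomputable def chordHamiltonian (R : ℝ) (Γ : Fin N → ℝ) (x : Fin N → R3) : ℝ :=
  -(1 / (4 * Real.pi * R ^ 2)) *
    ∑ i, ∑ j ∈ Finset.Ioi i, Γ i * Γ j * Real.log (‖x i - x j‖ ^ 2)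

/-- The gradient of `chordHamiltonian` with respect to the `i`-th point. -/
noncomputable def chordGradient (R : ℝ) (Γ : Fin N → ℝ) (x : Fin N → R3) (i : Fin N) : R3 :=
  -(1 / (4 * Real.pi * R ^ 2)) •
    ∑ j ∈ Finset.univ.erase i, (2 * Γ i * Γ j / ‖x i - x j‖ ^ 2) • (x i - x j)

/-- With a = ‖φᵢ‖² and b = ‖φⱼ‖², `norm_inner_sq` turns (a + b)² - 4|φᵢ*φⱼ|² into a² + b² - 2
h(φᵢ)·h(φⱼ), and ‖h(φᵢ)‖ = a. No restriction to the level set is needed. -/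
theorem liftedDistSq_eq (φ : PhaseSpace N) (i j : Fin N) :
    liftedDistSq φ i j = ‖hopfN φ i - hopfN φ j‖ ^ 2 := by
  have h := norm_inner_sq (φ i) (φ j)
  rw [liftedDistSq, norm_sub_sq_real, hopfN, hopfN, norm_hopf_sq, norm_hopf_sq]
  linarith

theorem mem_liftedNonCollision_iff {φ : PhaseSpace N} :
    φ ∈ liftedNonCollision N ↔ ∀ i j, i ≠ j → hopfN φ i ≠ hopfN φ j := by
  refine forall_congr' fun i => forall_congr' fun j => imp_congr_right fun _ => ?_
  rw [liftedDistSq_eq, ne_eq, sq_eq_zero_iff, norm_eq_zero, sub_eq_zero]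

theorem liftedHamiltonian_eq_comp :
    liftedHamiltonian R Γ = chordHamiltonian R Γ ∘ hopfN := by
  ext φ
  simp only [liftedHamiltonian, Function.comp_apply, chordHamiltonian, liftedDistSq_eq]

/-- The two formulas differ off the spheres. The chordal one makes H = F ∘ h hold everywhere, so it
is the one to differentiate; their derivatives agree along tangent vectors. -/
theorem chordHamiltonian_eqOn :
    EqOn (vortexHamiltonian R Γ) (chordHamiltonian R Γ) (sphereProduct N R) := by
  intro x hx
  simp only [vortexHamiltonian, chordHamiltonian]
  congr 1
  refine Finset.sum_congr rfl fun i _ => Finset.sum_congr rfl fun j _ => ?_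
  rw [norm_sub_sq_of_mem_sphere (mem_sphere_zero_iff_norm.1 (hx i))
    (mem_sphere_zero_iff_norm.1 (hx j))]

theorem norm_sub_sq_ne_zero {x : Fin N → R3} (hx : ∀ i j, i ≠ j → x i ≠ x j) {i j : Fin N}
    (hij : i ≠ j) : ‖x i - x j‖ ^ 2 ≠ 0 :=
  pow_ne_zero 2 (norm_ne_zero_iff.2 (sub_ne_zero.2 (hx i j hij)))

theorem differentiableAt_chordHamiltonian {x : Fin N → R3} (hx : ∀ i j, i ≠ j → x i ≠ x j) :
    DifferentiableAt ℝ (chordHamiltonian R Γ) x := by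
  refine (DifferentiableAt.fun_sum fun i _ => DifferentiableAt.fun_sum fun j hj => ?_).const_mul _
  have hd : DifferentiableAt ℝ (fun y : Fin N → R3 => y i - y j) x := by fun_prop
  exact ((hd.norm_sq ℝ).log (norm_sub_sq_ne_zero hx (Finset.mem_Ioi.1 hj).ne)).const_mul _

theorem differentiableAt_vortexHamiltonian {x : Fin N → R3} (hxS : x ∈ sphereProduct N R)
    (hx : ∀ i j, i ≠ j → x i ≠ x j) : DifferentiableAt ℝ (vortexHamiltonian R Γ) x := by
  refine (DifferentiableAt.fun_sum fun i _ => DifferentiableAt.fun_sum fun j hj =>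
    DifferentiableAt.const_mul (DifferentiableAt.log (DifferentiableAt.const_mul
      (DifferentiableAt.const_sub (DifferentiableAt.inner ℝ ?_ ?_) _) _) ?_) _).const_mul _
  · fun_prop
  · fun_prop
  · rw [← norm_sub_sq_of_mem_sphere (mem_sphere_zero_iff_norm.1 (hxS i))
      (mem_sphere_zero_iff_norm.1 (hxS j))]
    exact norm_sub_sq_ne_zero hx (Finset.mem_Ioi.1 hj).ne

theorem fderiv_chordHamiltonian_apply {x : Fin N → R3} (hx : ∀ i j, i ≠ j → x i ≠ x j)
    (y : Fin N → R3) :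
    fderiv ℝ (chordHamiltonian R Γ) x y = ∑ i, inner ℝ (chordGradient R Γ x i) (y i) := by
  have hterm : ∀ i, ∀ j ∈ Finset.Ioi i, HasDerivAt
      (fun t : ℝ => Γ i * Γ j * Real.log (‖(x + t • y) i - (x + t • y) j‖ ^ 2))
      (Γ i * Γ j * (2 * inner ℝ (x i - x j) (y i - y j) / ‖x i - x j‖ ^ 2)) 0 := by
    intro i j hj
    have hline : ∀ k, HasDerivAt (fun t : ℝ => (x + t • y) k) (y k) 0 := fun k => by
      simpa using ((hasDerivAt_id (0 : ℝ)).smul_const (y k)).const_add (x k)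
    have h := ((hline i).sub (hline j)).norm_sq.log (by
      simpa using sub_ne_zero.2 (hx i j (Finset.mem_Ioi.1 hj).ne))
    simpa using h.const_mul (Γ i * Γ j)
  have hsum := (HasDerivAt.fun_sum fun i (_ : i ∈ Finset.univ) =>
    HasDerivAt.fun_sum (hterm i)).const_mul (-(1 / (4 * Real.pi * R ^ 2)))
  rw [fderiv_apply_of_hasDerivAt_line (differentiableAt_chordHamiltonian hx) hsum]
  -- Each pair i < j contributes one term in `y i` and one in `y j`; collecting by the point that
  -- moves gives the sum over all j ≠ i.
  have hsymm := Finset.sum_sum_Ioi_add_eq_sum_sum_off_diag fun j i =>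
    2 * Γ i * Γ j / ‖x i - x j‖ ^ 2 * inner ℝ (x i - x j) (y i)
  have hleft : ∑ i, ∑ j ∈ Finset.Ioi i,
      Γ i * Γ j * (2 * inner ℝ (x i - x j) (y i - y j) / ‖x i - x j‖ ^ 2) =
      ∑ i, ∑ j ∈ Finset.Ioi i, (2 * Γ i * Γ j / ‖x i - x j‖ ^ 2 * inner ℝ (x i - x j) (y i)
        + 2 * Γ j * Γ i / ‖x j - x i‖ ^ 2 * inner ℝ (x j - x i) (y j)) := by
    refine Finset.sum_congr rfl fun i _ => Finset.sum_congr rfl fun j _ => ?_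
    rw [norm_sub_rev (x j), ← neg_sub (x i) (x j), inner_neg_left, inner_sub_right]
    ring
  rw [hleft, hsymm, Finset.mul_sum]
  refine Finset.sum_congr rfl fun i _ => ?_
  rw [chordGradient, real_inner_smul_left, sum_inner, Finset.compl_singleton]
  simp only [real_inner_smul_left]

theorem cross3_smul_left (c : ℝ) (x y : R3) : cross3 (c • x) y = c • cross3 x y := by
  refine R3_ext ?_ ?_ ?_ <;> simp [cross3_zero, cross3_one, cross3_two] <;> ring

theorem cross3_sum_left {ι : Type*} (s : Finset ι) (f : ι → R3) (y : R3) :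
    cross3 (∑ j ∈ s, f j) y = ∑ j ∈ s, cross3 (f j) y := by
  refine R3_ext ?_ ?_ ?_ <;>
  simp [cross3_zero, cross3_one, cross3_two, Finset.sum_mul]

theorem cross3_sub_self (x y : R3) : cross3 (x - y) x = -cross3 y x := by
  refine R3_ext ?_ ?_ ?_ <;> simp [cross3_zero, cross3_one, cross3_two] <;> ring

/-- In the cross product of the gradient with xᵢ, the part of xᵢ - xⱼ along xᵢ drops out. This is
the form in which the rotation generated by the gradient is visible. -/
theorem vortexField_eq (hR : 0 < R) (hΓ : ∀ i, Γ i ≠ 0) (x : Fin N → R3) (i : Fin N) :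
    vortexField R Γ x i = (R / Γ i) • cross3 (chordGradient R Γ x i) (x i) := by
  have hπ := Real.pi_pos.ne'
  have hi := hΓ i
  rw [vortexField, chordGradient, cross3_smul_left, cross3_sum_left, Finset.smul_sum,
    Finset.smul_sum, Finset.smul_sum]
  refine Finset.sum_congr rfl fun j _ => ?_
  rw [cross3_smul_left, cross3_sub_self, smul_neg, smul_neg, smul_neg, smul_smul, smul_smul,
    smul_smul, ← neg_smul]
  congr 1
  field_simp
  ring

/-- The adjoint of dh(φ) is y ↦ 2(y·σ)φ. Gradients of functions of h(φ) are pulled back by it, and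
the 2 cancels against the ½ of the Wirtinger derivative. -/
theorem inner_dHopf_right (y : R3) (φ w : C2) :
    inner ℝ y (dHopf φ w) = 2 * inner ℝ (pauli y φ) w := by
  rw [inner_R3, real_inner_C2]
  simp only [dHopf_zero, dHopf_one, dHopf_two, pauli_zero_re, pauli_zero_im, pauli_one_re,
    pauli_one_im]
  ring

/-- φ*(y·σ)φ is real because y·σ is Hermitian. This is the infinitesimal conservation of each ‖φᵢ‖.
-/
theorem inner_I_smul_pauli (y : R3) (φ : C2) : inner ℝ φ (Complex.I • pauli y φ) = 0 := by
  rw [real_inner_C2]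
  simp [pauli_zero_re, pauli_zero_im, pauli_one_re, pauli_one_im]
  ring

theorem differentiableAt_liftedHamiltonian {φ : PhaseSpace N} (hφ : φ ∈ liftedNonCollision N) :
    DifferentiableAt ℝ (liftedHamiltonian R Γ) φ := by
  rw [liftedHamiltonian_eq_comp]
  exact (differentiableAt_chordHamiltonian (mem_liftedNonCollision_iff.1 hφ)).comp φ
    (contDiff_hopfN.differentiable (by simp) φ)

theorem fderiv_liftedHamiltonian_apply {φ : PhaseSpace N} (hφ : φ ∈ liftedNonCollision N)
    (w : PhaseSpace N) : fderiv ℝ (liftedHamiltonian R Γ) φ w =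
      ∑ i, 2 * inner ℝ (pauli (chordGradient R Γ (hopfN φ) i) (φ i)) (w i) := by
  have hx := mem_liftedNonCollision_iff.1 hφ
  rw [liftedHamiltonian_eq_comp, fderiv_comp φ (differentiableAt_chordHamiltonian hx)
    (contDiff_hopfN.differentiable (by simp) φ), ContinuousLinearMap.comp_apply,
    fderiv_hopfN_apply, fderiv_chordHamiltonian_apply hx]
  simp only [inner_dHopf_right]

/-- The Wirtinger gradient is half the Euclidean gradient. -/
theorem conjGradient_eq {F : PhaseSpace N → ℝ} {φ G : PhaseSpace N}
    (h : ∀ w, fderiv ℝ F φ w = ∑ i, 2 * inner ℝ (G i) (w i)) : conjGradient F φ = G := by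
  have hsingle : ∀ i (v : C2), fderiv ℝ F φ (Pi.single i v) = 2 * inner ℝ (G i) v := by
    intro i v
    rw [h, Finset.sum_eq_single i, Pi.single_eq_same]
    · intro j _ hj
      rw [Pi.single_eq_of_ne hj, inner_zero_right, mul_zero]
    · simp
  ext i k
  simp only [conjGradient, hsingle]
  fin_cases k <;> apply Complex.ext <;> simp [real_inner_C2]

theorem conjGradient_liftedHamiltonian {φ : PhaseSpace N} (hφ : φ ∈ liftedNonCollision N) :
    conjGradient (liftedHamiltonian R Γ) φ =
      fun i => pauli (chordGradient R Γ (hopfN φ) i) (φ i) :=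
  conjGradient_eq (fderiv_liftedHamiltonian_apply hφ)

theorem hamilton_iff_isLiftedVelocity (hR : 0 < R) {φ : PhaseSpace N}
    (hφ : φ ∈ liftedNonCollision N) (X : PhaseSpace N) :
    (∀ w, liftedOmega R Γ φ X w = fderiv ℝ (liftedHamiltonian R Γ) φ w) ↔
      IsLiftedVelocity R Γ R φ X := by
  set G : PhaseSpace N := fun i => pauli (chordGradient R Γ (hopfN φ) i) (φ i) with hG
  -- The defect in Hamilton's equation is the pairing of `w` with a fixed vector, so it vanishes for
  -- all `w` exactly when each component of that vector is zero.
  have hdiff : ∀ w, liftedOmega R Γ φ X w - fderiv ℝ (liftedHamiltonian R Γ) φ w =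
      ∑ i, inner ℝ ((4 / R * Γ i) • (Complex.I • X i) - (2 : ℝ) • G i) (w i) := by
    intro w
    rw [liftedOmega_apply, fderiv_liftedHamiltonian_apply hφ, Finset.mul_sum,
      ← Finset.sum_sub_distrib]
    refine Finset.sum_congr rfl fun i _ => ?_
    rw [inner_sub_left, real_inner_smul_left, real_inner_smul_left, im_inner_eq_real_inner]
    ring
  have hR' : (R : ℂ) ≠ 0 := Complex.ofReal_ne_zero.2 hR.ne'
  have hiff : ∀ i, (4 / R * Γ i) • (Complex.I • X i) - (2 : ℝ) • G i = 0 ↔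
      (Γ i : ℂ) • X i = (-(Complex.I * (R : ℂ) / 2)) • G i := by
    intro i
    have h1 : (4 / R * Γ i) • (Complex.I • X i) - (2 : ℝ) • G i =
        (4 * Complex.I / R) • ((Γ i : ℂ) • X i - (-(Complex.I * (R : ℂ) / 2)) • G i) := by
      rw [← Complex.coe_smul, ← Complex.coe_smul, smul_sub, smul_smul, smul_smul, smul_smul]
      congr 2
      · push_cast
        ring
      · push_cast
        field_simp
        rw [Complex.I_sq]
        ring
    rw [h1, smul_eq_zero, sub_eq_zero, or_iff_right]
    exact div_ne_zero (mul_ne_zero (by norm_num) Complex.I_ne_zero) hR'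
  rw [IsLiftedVelocity, conjGradient_liftedHamiltonian hφ]
  simp only [← sub_eq_zero (a := liftedOmega R Γ φ X _), hdiff]
  constructor
  · intro h i
    refine (hiff i).1 ?_
    have h1 := h (Pi.single i ((4 / R * Γ i) • (Complex.I • X i) - (2 : ℝ) • G i))
    rw [Finset.sum_eq_single i, Pi.single_eq_same] at h1
    · exact inner_self_eq_zero.1 h1
    · intro j _ hj
      rw [Pi.single_eq_of_ne hj, inner_zero_right]
    · simp
  · intro h w
    exact Finset.sum_eq_zero fun i _ => by rw [(hiff i).2 (h i), inner_zero_left]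

theorem isLiftedVelocity_iff (hΓ : ∀ i, Γ i ≠ 0) {c : ℝ} {φ : PhaseSpace N}
    (hφ : φ ∈ liftedNonCollision N) {X : PhaseSpace N} :
    IsLiftedVelocity R Γ c φ X ↔ ∀ i, X i =
      (c / Γ i) • ((-(Complex.I / 2)) • pauli (chordGradient R Γ (hopfN φ) i) (φ i)) := by
  rw [IsLiftedVelocity, conjGradient_liftedHamiltonian hφ]
  refine forall_congr' fun i => ?_
  have hi : (Γ i : ℂ) ≠ 0 := Complex.ofReal_ne_zero.2 (hΓ i)
  rw [← eq_inv_smul_iff₀ hi, ← Complex.coe_smul, smul_smul, smul_smul]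
  have : ((Γ i : ℂ)⁻¹ * -(Complex.I * (c : ℂ) / 2)) = ((c / Γ i : ℝ) : ℂ) * -(Complex.I / 2) := by
    push_cast
    ring
  rw [this]

theorem inner_liftedVelocity (hΓ : ∀ i, Γ i ≠ 0) {c : ℝ} {φ X : PhaseSpace N}
    (hφ : φ ∈ liftedNonCollision N) (hX : IsLiftedVelocity R Γ c φ X) (i : Fin N) :
    inner ℝ (φ i) (X i) = 0 := by
  have h : (-(Complex.I / 2)) • pauli (chordGradient R Γ (hopfN φ) i) (φ i) =
      (-(1 / 2 : ℝ)) • (Complex.I • pauli (chordGradient R Γ (hopfN φ) i) (φ i)) := by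
    rw [← Complex.coe_smul, smul_smul]
    congr 1
    push_cast
    ring
  rw [(isLiftedVelocity_iff hΓ hφ).1 hX i, h, real_inner_smul_right, real_inner_smul_right,
    inner_I_smul_pauli, mul_zero, mul_zero]

/-- By `dHopf_I_pauli` the projected velocity is (c/Γᵢ) gᵢ × xᵢ, to be compared with (R/Γᵢ) gᵢ × xᵢ
in `vortexField_eq`. Keeping `c` general covers both equations, `c = R` and `c = 1`. -/
theorem fderiv_hopfN_liftedVelocity (hR : 0 < R) (hΓ : ∀ i, Γ i ≠ 0) {c : ℝ} {φ X : PhaseSpace N}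
    (hφ : φ ∈ liftedNonCollision N) (hX : IsLiftedVelocity R Γ c φ X) :
    fderiv ℝ hopfN φ X = (c / R) • vortexField R Γ (hopfN φ) := by
  rw [fderiv_hopfN_apply]
  ext1 i
  have hi := hΓ i
  rw [(isLiftedVelocity_iff hΓ hφ).1 hX i, dHopf_real_smul, dHopf_I_pauli, Pi.smul_apply,
    vortexField_eq hR hΓ, smul_smul]
  congr 1
  field_simp

theorem vortexField_mem_tangentVectors (hR : 0 < R) (hΓ : ∀ i, Γ i ≠ 0) {x : Fin N → R3}
    (hx : x ∈ sphereProduct N R) : vortexField R Γ x ∈ tangentVectors (sphereProduct N R) x := by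
  rw [mem_tangentVectors_sphereProduct hR hx]
  intro i
  rw [vortexField_eq hR hΓ, real_inner_smul_right, inner_cross3_right_self, mul_zero]

theorem vortexField_hamiltonian (hR : 0 < R) (hΓ : ∀ i, Γ i ≠ 0) {x : Fin N → R3}
    (hxS : x ∈ sphereProduct N R) (hx : ∀ i j, i ≠ j → x i ≠ x j) {w : Fin N → R3}
    (hw : w ∈ tangentVectors (sphereProduct N R) x) :
    (R ^ 2)⁻¹ * vortexForm R Γ x (vortexField R Γ x) w
      = fderiv ℝ (vortexHamiltonian R Γ) x w := by
  rw [fderiv_eq_of_eqOn_of_mem_tangentVectors (differentiableAt_vortexHamiltonian hxS hx)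
    (differentiableAt_chordHamiltonian hx) chordHamiltonian_eqOn hw,
    fderiv_chordHamiltonian_apply hx, vortexForm, Finset.mul_sum]
  rw [mem_tangentVectors_sphereProduct hR hxS] at hw
  refine Finset.sum_congr rfl fun i _ => ?_
  have hi := hΓ i
  -- Here x·((g × x) × w) = ‖x‖² g·w - (x·g)(x·w), whose last term vanishes for tangent w. The
  -- constants R⁻² · R⁻¹ · R · R² multiply to 1.
  rw [areaForm, vortexField_eq hR hΓ, ← cross3_smul_left, inner_cross3_triple, hw i,
    mem_sphere_zero_iff_norm.1 (hxS i), real_inner_smul_left]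
  field_simp
  ring

/-! ### Solutions: conservation of the norms and projection to the spheres -/

theorem norm_sq_liftedSolution (hΓ : ∀ i, Γ i ≠ 0) {c : ℝ} {I : Set ℝ} (hI : IsOpen I)
    (hI' : I.OrdConnected) {φ : ℝ → PhaseSpace N} (hφ : IsLiftedSolution R Γ c φ I) {s t : ℝ}
    (hs : s ∈ I) (ht : t ∈ I) (i : Fin N) : ‖φ t i‖ ^ 2 = ‖φ s i‖ ^ 2 := by
  have hd : ∀ t ∈ I, HasDerivAt (fun t => ‖φ t i‖ ^ 2) 0 t := by
    intro t ht
    obtain ⟨hnc, X, hX, hvel⟩ := hφ t ht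
    refine (hasDerivAt_pi.1 hX i).norm_sq.congr_deriv ?_
    rw [inner_liftedVelocity hΓ hnc hvel, mul_zero]
  exact hI.is_const_of_deriv_eq_zero hI'.isPreconnected
    (fun t ht => (hd t ht).differentiableAt.differentiableWithinAt)
    (fun t ht => (hd t ht).deriv) ht hs

theorem liftedSolution_mem_momentumLevel (hR : 0 < R) (hΓ : ∀ i, Γ i ≠ 0) {c : ℝ} {I : Set ℝ}
    (hI : IsOpen I) (hI' : I.OrdConnected) {φ : ℝ → PhaseSpace N}
    (hφ : IsLiftedSolution R Γ c φ I) {t₀ : ℝ} (ht₀ : t₀ ∈ I)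
    (h0 : φ t₀ ∈ momentumMap R Γ ⁻¹' {fun i => -2 * Γ i}) :
    ∀ t ∈ I, φ t ∈ momentumMap R Γ ⁻¹' {fun i => -2 * Γ i} := by
  intro t ht
  rw [mem_momentumLevel_iff hR hΓ] at h0 ⊢
  exact fun i => (norm_sq_liftedSolution hΓ hI hI' hφ ht₀ ht i).trans (h0 i)

theorem hasDerivAt_hopfN_liftedSolution (hR : 0 < R) (hΓ : ∀ i, Γ i ≠ 0) {c : ℝ} {I : Set ℝ}
    {φ : ℝ → PhaseSpace N} (hφ : IsLiftedSolution R Γ c φ I) {t : ℝ} (ht : t ∈ I) :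
    HasDerivAt (fun t => hopfN (φ t)) ((c / R) • vortexField R Γ (hopfN (φ t))) t := by
  obtain ⟨hnc, X, hX, hvel⟩ := hφ t ht
  rw [← fderiv_hopfN_liftedVelocity hR hΓ hnc hvel]
  exact (contDiff_hopfN.differentiable (by simp) (φ t)).hasFDerivAt.comp_hasDerivAt t hX

end Dynamics

theorem mainTheorem4 (N : ℕ) (R : ℝ) (hR : 0 < R) (Γ : Fin N → ℝ) (hΓ : ∀ i, Γ i ≠ 0) :
    -- the level set `J⁻¹(-2Γ)` is the product of the three-spheres of radius `√R`
    (momentumMap R Γ ⁻¹' {fun i => -2 * Γ i}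
      = {φ : PhaseSpace N | ∀ i, φ i ∈ Metric.sphere (0 : C2) (Real.sqrt R)}) ∧
    -- `(𝕊²_R)ᴺ` with the Hopf map is the Marsden–Weinstein quotient at the level `-2Γ`
    IsMarsdenWeinsteinQuotient (liftedOmega R Γ) (momentumMap R Γ) (fun i => -2 * Γ i)
      (sphereProduct N R) N (fun x v w => (R ^ 2)⁻¹ * vortexForm R Γ x v w) hopfN ∧
    -- the orbit spaces: `J⁻¹(-2Γ)/𝕋ᴺ = (𝕊³_{√R}/𝕊¹)ᴺ = (𝕊²_R)ᴺ`
    (∃ (Ψ : OrbitSpace (momentumLevel R Γ) ≃ₜ (Fin N → OrbitSpace (threeSphere R)))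
        (χ : OrbitSpace (threeSphere R) ≃ₜ Metric.sphere (0 : R3) R)
        (Φ : OrbitSpace (momentumLevel R Γ) ≃ₜ sphereProduct N R),
      (∀ (φ : momentumLevel R Γ) (i : Fin N), ∃ h : (φ : PhaseSpace N) i ∈ threeSphere R,
        Ψ (toOrbit (momentumLevel R Γ) φ) i
          = toOrbit (threeSphere R) ⟨(φ : PhaseSpace N) i, h⟩) ∧
      (∀ ψ : threeSphere R, (χ (toOrbit (threeSphere R) ψ) : R3) = hopf ψ) ∧
      (∀ φ : momentumLevel R Γ,
        (Φ (toOrbit (momentumLevel R Γ) φ) : Fin N → R3) = hopfN (φ : PhaseSpace N)) ∧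
      (∀ q i, (Φ q : Fin N → R3) i = χ (Ψ q i)) ∧
      IsOrbitDiffeo χ ∧ IsOrbitDiffeo Φ) ∧
    -- the Hamiltonian is `𝕋ᴺ`-invariant and descends to the Hamiltonian on `(𝕊²_R)ᴺ`
    (∀ (g : Torus N) (φ : PhaseSpace N),
      liftedHamiltonian R Γ (g • φ) = liftedHamiltonian R Γ φ) ∧
    (∀ φ ∈ momentumMap R Γ ⁻¹' {fun i => -2 * Γ i},
      liftedHamiltonian R Γ φ = vortexHamiltonian R Γ (hopfN φ)) ∧
    -- Hamilton's equations `ι_X Ω = dH` are the lifted vortex equations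
    (∀ φ ∈ liftedNonCollision N, DifferentiableAt ℝ (liftedHamiltonian R Γ) φ ∧
      ∀ X : PhaseSpace N, (∀ w, liftedOmega R Γ φ X w = fderiv ℝ (liftedHamiltonian R Γ) φ w)
        ↔ IsLiftedVelocity R Γ R φ X) ∧
    -- their vector field is tangent to the level set and projects to the vortex vector field
    (∀ φ ∈ momentumMap R Γ ⁻¹' {fun i => -2 * Γ i},
      (φ ∈ liftedNonCollision N ↔ ∀ i j, i ≠ j → hopfN φ i ≠ hopfN φ j) ∧
      (φ ∈ liftedNonCollision N → ∀ X, IsLiftedVelocity R Γ R φ X →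
        X ∈ tangentVectors (momentumMap R Γ ⁻¹' {fun i => -2 * Γ i}) φ ∧
        fderiv ℝ hopfN φ X = vortexField R Γ (hopfN φ))) ∧
    -- the vortex vector field is the Hamiltonian vector field of the reduced system
    (∀ x ∈ sphereProduct N R, (∀ i j, i ≠ j → x i ≠ x j) →
      vortexField R Γ x ∈ tangentVectors (sphereProduct N R) x ∧
      DifferentiableAt ℝ (vortexHamiltonian R Γ) x ∧
      ∀ w ∈ tangentVectors (sphereProduct N R) x,
        (R ^ 2)⁻¹ * vortexForm R Γ x (vortexField R Γ x) w
          = fderiv ℝ (vortexHamiltonian R Γ) x w) ∧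
    -- solutions in the level set stay there and project to solutions of the vortex equations
    (∀ (I : Set ℝ), IsOpen I → I.OrdConnected → ∀ φ : ℝ → PhaseSpace N,
      ∀ t₀ ∈ I, φ t₀ ∈ momentumMap R Γ ⁻¹' {fun i => -2 * Γ i} →
      (IsLiftedSolution R Γ R φ I →
        (∀ t ∈ I, φ t ∈ momentumMap R Γ ⁻¹' {fun i => -2 * Γ i}) ∧
        IsVortexSolution R Γ (fun t => hopfN (φ t)) I) ∧
      -- without the factor `R` on the right-hand side: the same up to the time change `t ↦ R t`
      (IsLiftedSolution R Γ 1 φ I →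
        (∀ t ∈ I, φ t ∈ momentumMap R Γ ⁻¹' {fun i => -2 * Γ i}) ∧
        IsVortexSolution R Γ (fun t => hopfN (φ (R * t))) {t | R * t ∈ I})) := by
  refine ⟨momentumLevel_eq_piSphere hR hΓ, isMarsdenWeinsteinQuotient_hopfN hR hΓ,
    orbitSpace_identifications hR hΓ, liftedHamiltonian_torus_smul, fun φ hφ => ?_, fun φ hφ =>
      ⟨differentiableAt_liftedHamiltonian hφ, hamilton_iff_isLiftedVelocity hR hφ⟩,
    fun φ hφ => ⟨mem_liftedNonCollision_iff, fun hnc X hX => ⟨?_, ?_⟩⟩,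
    fun x hxS hx => ⟨vortexField_mem_tangentVectors hR hΓ hxS,
      differentiableAt_vortexHamiltonian hxS hx, fun w hw => vortexField_hamiltonian hR hΓ hxS hx hw⟩,
    fun I hI hI' φ t₀ ht₀ h0 => ⟨fun hφ => ?_, fun hφ => ?_⟩⟩
  · rw [mem_momentumLevel_iff hR hΓ] at hφ
    rw [liftedHamiltonian_eq_comp, Function.comp_apply,
      chordHamiltonian_eqOn (hopfN_mem_sphereProduct hφ)]
  · exact (mem_tangentVectors_momentumLevel hR hΓ hφ).2 (inner_liftedVelocity hΓ hnc hX)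
  · rw [fderiv_hopfN_liftedVelocity hR hΓ hnc hX, div_self hR.ne', one_smul]
  · have hlevel := liftedSolution_mem_momentumLevel hR hΓ hI hI' hφ ht₀ h0
    refine ⟨hlevel, fun t ht =>
      ⟨hopfN_mem_sphereProduct ((mem_momentumLevel_iff hR hΓ).1 (hlevel t ht)),
        mem_liftedNonCollision_iff.1 (hφ t ht).1, ?_⟩⟩
    simpa [hR.ne'] using hasDerivAt_hopfN_liftedSolution hR hΓ hφ ht
  · have hlevel := liftedSolution_mem_momentumLevel hR hΓ hI hI' hφ ht₀ h0
    refine ⟨hlevel, fun t ht =>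
      ⟨hopfN_mem_sphereProduct ((mem_momentumLevel_iff hR hΓ).1 (hlevel _ ht)),
        mem_liftedNonCollision_iff.1 (hφ _ ht).1, ?_⟩⟩
    -- For `c = 1` the projected velocity is 1/R times the vortex field; the inner derivative of t ↦
    -- Rt restores the factor.
    have h := (hasDerivAt_hopfN_liftedSolution hR hΓ hφ ht).scomp t
      ((hasDerivAt_id t).const_mul R)
    refine h.congr_deriv ?_
    rw [smul_smul, mul_one, mul_one_div_cancel hR.ne', one_smul]
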